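/- Let $E$ be a Polish space and let $(X_t,(\mathbb P_x)_{x\in E})$ be a conservative continuous-time (jointly measurable, time-homogeneous) Markov process on $E$ with semigroup $(P_t)_{t\ge 0}$ and invariant probability measure $\mu$. Let $L$, with domain $D(L)\subset \mathbb L^2(\mu)$, be the infinitesimal generator of $(P_t)$ on $\mathbb L^2(\mu)$, and write $\langle f,g\rangle_\mu=\int fg\,d\mu$ and $\mathbb P_\nu=\int \mathbb P_x\,\nu(dx)$. Call $F:\mathbb R^+\to\mathbb R$ *contractive* if $F(x)\to+\infty$ as $x\to+\infty$ and $G(x):=xF(x)$ is a normalised Young function: $G$ is convex and non-decreasing on $\mathbb R^+$, $G(0)=0$ and $G(1)+G^*(1)=1$, where $G^*(y)=\sup_{x\ge0}(xy-G(x))$. Put $N_{G^*}(V)=\inf\{u>0:\int G^*(|V|/u)\,d\mu\le G^*(1)\}\in[0,\infty]$. Assume that $F$ is contractive and that $\mu$ satisfies the strong $F$-Sobolev inequality with constant $C_{SF}>0$: for all $g\in D(L)$ with $\int g\,d\mu=0$ and $\int g^2\,d\mu=1$, $$\int g^2F(g^2)\,d\mu\le -C_{SF}\,\langle Lg,g\rangle_\mu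 .$$ Let $V$ satisfy $\int V\,d\mu=0$ and $\int V^2\,d\mu=m^2<+\infty$, and let $\nu$ be a probability measure absolutely continuous with respect to $\mu$. Then for all $t>0$ and $R>0$ the integral $\int_0^tV(X_s)\,ds$ is $\mathbb P_\nu$-almost surely well defined and $$\mathbb P_\nu\left(\frac1t\int_0^tV(X_s)\,ds\ge R\right)\le\left\|\frac{d\nu}{d\mu}\right\|_{\mathbb L^2(\mu)}\exp\left\{-t\sup_{0\le\lambda\le\lambda_2}\left(R\lambda-\frac{2m^2C_{SF}}{G(1)}\lambda^2\right)\right\},\qquad \lambda_2=\frac{G(1)}{2C_{SF}N_{G^*}(V)} .$$ Conventions: if $G(1)=0$ then $\lambda_2=0$ and the supremum is $0$; if $G(1)>0$, then $\lambda_2=0$ when $N_{G^*}(V)=\infty$, and $\lambda_2=\infty$ (all $\lambda\ge0$ allowed) when $N_{G^*}(V)=0$; $e^{-\infty}=0$ and $\infty\cdot 0=0$. -/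

import Mathlib

open MeasureTheory ProbabilityTheory Filter Topology
open scoped NNReal ENNReal

/-! ## Markov processes, their semigroups and their `L²` generators -/

/-- A conservative continuous-time Markov process `(X_t, (P_x)_{x ∈ E})` with state space `E`,
defined on `Ω`: `law x` is the probability `P_x`, under which the process starts at `x`, and the
(time-homogeneous) Markov property holds with respect to the natural filtration of `X`. -/
structure MarkovProcess (E Ω : Type*) [MeasurableSpace E] [MeasurableSpace Ω] where
  /-- The process, `X t ω` being the position at time `t`. -/
  X : ℝ≥0 → Ω → E
  /-- The probabilities `P_x`, depending measurably on `x`. -/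
  law : Kernel E Ω
  isMarkov_law : IsMarkovKernel law
  measurable_X : Measurable (fun p : ℝ≥0 × Ω => X p.1 p.2)
  map_X_zero : ∀ x : E, (law x).map (X 0) = Measure.dirac x
  markov : ∀ (x : E) (s t : ℝ≥0) (A : Set Ω) (B : Set E),
    MeasurableSet[⨆ u : ℝ≥0, ⨆ _ : u ≤ s, MeasurableSpace.comap (X u) inferInstance] A →
    MeasurableSet B →
    law x (A ∩ {ω | X (s + t) ω ∈ B}) = ∫⁻ ω in A, law (X s ω) {ω' | X t ω' ∈ B} ∂(law x)

namespace MarkovProcess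

variable {E Ω : Type*} [MeasurableSpace E] [MeasurableSpace Ω]

/-- The transition kernels, `transition t x B = P_x(X_t ∈ B)`. -/
noncomputable def transition (M : MarkovProcess E Ω) (t : ℝ≥0) : Kernel E E :=
  M.law.map (M.X t)

theorem measurable_X_at (M : MarkovProcess E Ω) (t : ℝ≥0) : Measurable (M.X t) :=
  M.measurable_X.comp measurable_prodMk_left

instance isMarkovKernel_transition (M : MarkovProcess E Ω) (t : ℝ≥0) :
    IsMarkovKernel (M.transition t) :=
  haveI := M.isMarkov_law
  Kernel.IsMarkovKernel.map _ (M.measurable_X_at t)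

/-- The transition semigroup, `(P_t f)(x) = E_x[f(X_t)]`. -/
noncomputable def semigroup (M : MarkovProcess E Ω) (t : ℝ≥0) (f : E → ℝ) (x : E) : ℝ :=
  ∫ y, f y ∂(M.transition t x)

/-- The law `P_ν = ∫ P_x ν(dx)` of the process with initial distribution `ν`. -/
noncomputable def initLaw (M : MarkovProcess E Ω) (ν : Measure E) : Measure Ω :=
  ν.bind M.law

/-- `μ` is invariant: `μ P_t = μ` for all `t ≥ 0`. -/
def IsInvariant (M : MarkovProcess E Ω) (μ : Measure E) : Prop :=
  ∀ t : ℝ≥0, (M.transition t).Invariant μ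

/-- `M.HasGenerator μ f h` says that `f` belongs to the domain `D(L)` of the infinitesimal
generator `L` of the semigroup `(P_t)` on `L²(μ)`, and that `L f = h`:
`f, h ∈ L²(μ)` and `(P_t f - f) / t → h` in `L²(μ)` as `t` decreases to `0`. -/
def HasGenerator (M : MarkovProcess E Ω) (μ : Measure E) (f h : E → ℝ) : Prop :=
  MemLp f 2 μ ∧ MemLp h 2 μ ∧
    Tendsto (fun t : ℝ≥0 =>
        eLpNorm (fun x => (t : ℝ)⁻¹ * (M.semigroup t f x - f x) - h x) 2 μ)
      (𝓝[>] 0) (𝓝 0)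

end MarkovProcess

/-! ## Contractive functions, Young functions and gauge norms -/

/-- The function `G(x) = x F(x)`; only its values on `[0, ∞)` matter. -/
def youngOf (F : ℝ → ℝ) (x : ℝ) : ℝ := x * F x

/-- The Fenchel-Legendre conjugate `G^*(y) = sup_{x ≥ 0} (x y - G(x))` of a function `G` on
`[0, ∞)`. The supremum is finite when `G(x) = x F(x)` with `F` contractive, see
`IsContractive.bddAbove_conj`. -/
noncomputable def youngConj (G : ℝ → ℝ) (y : ℝ) : ℝ := ⨆ x : ℝ≥0, ((x : ℝ) * y - G x)

/-- `F`, a function on `[0, ∞)`, is contractive: it tends to `+∞` at infinity, and `G(x) = x F(x)`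
is a normalised Young function, i.e. convex and non-decreasing on `[0, ∞)` with `G(0) = 0` and
`G(1) + G^*(1) = 1`. -/
structure IsContractive (F : ℝ → ℝ) : Prop where
  tendsto_atTop : Tendsto F atTop atTop
  convexOn : ConvexOn ℝ (Set.Ici 0) (youngOf F)
  monotoneOn : MonotoneOn (youngOf F) (Set.Ici 0)
  map_zero : youngOf F 0 = 0
  normalised : youngOf F 1 + youngConj (youngOf F) 1 = 1

theorem IsContractive.bddAbove_conj {F : ℝ → ℝ} (hF : IsContractive F) (y : ℝ) :
    BddAbove (Set.range fun x : ℝ≥0 => (x : ℝ) * y - youngOf F x) := by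
  obtain ⟨a, ha⟩ := (hF.tendsto_atTop.eventually_ge_atTop y).exists_forall_of_atTop
  refine ⟨|a| * |y|, ?_⟩
  rintro _ ⟨x, rfl⟩
  have hx : (0 : ℝ) ≤ x := x.2
  have hG : 0 ≤ youngOf F x := by
    have := hF.monotoneOn (Set.mem_Ici.2 le_rfl) (Set.mem_Ici.2 hx) hx
    rwa [hF.map_zero] at this
  rcases le_total a x with h | h
  · have h1 := mul_le_mul_of_nonneg_left (ha x h) hx
    have h2 : 0 ≤ |a| * |y| := by positivity
    simp only [youngOf]
    linarith
  · have h1 : (x : ℝ) * y ≤ |a| * |y| :=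
      (mul_le_mul_of_nonneg_left (le_abs_self y) hx).trans
        (mul_le_mul_of_nonneg_right (h.trans (le_abs_self a)) (abs_nonneg y))
    simp only
    linarith

/-- The gauge norm `N_Φ(f) = inf {u > 0 ; ∫ Φ(|f| / u) dμ ≤ Φ(1)} ∈ [0, ∞]` of a nonnegative
function `Φ` on `[0, ∞)`, with value `∞` if there is no such `u`. -/
noncomputable def gaugeNorm {E : Type*} [MeasurableSpace E] (Φ : ℝ → ℝ) (μ : Measure E)
    (f : E → ℝ) : ℝ≥0∞ :=
  ⨅ (u : ℝ) (_ : 0 < u) (_ : ∫⁻ x, ENNReal.ofReal (Φ (|f x| / u)) ∂μ ≤ ENNReal.ofReal (Φ 1)),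
    ENNReal.ofReal u

/-! ## The functional inequality -/

/-- `μ` satisfies the strong `F`-Sobolev inequality with constant `C`: for all `g ∈ D(L)` with
`∫ g dμ = 0` and `∫ g² dμ = 1`, `∫ g² F(g²) dμ ≤ - C ⟨L g, g⟩_μ` (in particular the left-hand
side is finite). Here `h` stands for `L g`. -/
def StrongFSobolev {E Ω : Type*} [MeasurableSpace E] [MeasurableSpace Ω]
    (M : MarkovProcess E Ω) (μ : Measure E) (F : ℝ → ℝ) (C : ℝ) : Prop :=
  ∀ g h : E → ℝ, M.HasGenerator μ g h → ∫ x, g x ∂μ = 0 → ∫ x, g x ^ 2 ∂μ = 1 →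
    Integrable (fun x => g x ^ 2 * F (g x ^ 2)) μ ∧
      ∫ x, g x ^ 2 * F (g x ^ 2) ∂μ ≤ -C * ∫ x, h x * g x ∂μ

/-- The threshold `λ₂ = G(1) / (2 C N_{G^*}(V)) ∈ [0, ∞]`, where `G(x) = x F(x)`. -/
noncomputable def lambdaTwo {E : Type*} [MeasurableSpace E] (F : ℝ → ℝ) (C : ℝ) (μ : Measure E)
    (V : E → ℝ) : ℝ≥0∞ :=
  ENNReal.ofReal (youngOf F 1) /
    (2 * ENNReal.ofReal C * gaugeNorm (youngConj (youngOf F)) μ V)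

/-- The rate `sup_{0 ≤ l ≤ λ₂} (R l - (2 m² C / G(1)) l²) ∈ [0, ∞]`. -/
noncomputable def deviationRate (G₁ C m R : ℝ) (l₂ : ℝ≥0∞) : EReal :=
  ⨆ (l : ℝ) (_ : 0 ≤ l ∧ ENNReal.ofReal l ≤ l₂),
    ((R * l - (2 * m ^ 2 * C / G₁) * l ^ 2 : ℝ) : EReal)

/-! The proof is a Chernoff bound whose exponential moment is controlled by an `L²(μ)` energy
estimate for the Feynman-Kac functional.

For bounded `W` let `u_t(x) = E_x[exp ∫_0^t W(X_r) dr]` and `v_t(x) = E_x[exp(∫_0^t W(X_r) dr)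
W(X_t)]`. Moving the terminal time gives `∂_t u_t = v_t` (`feynmanKac_one_eq`). Moving the starting
time shows that `u_t` lies in the domain of the generator, with image `v_t - W u_t`
(`hasGenerator_feynmanKac`). Hence half the derivative of `‖u_t‖²` is the quadratic form of
generator plus `W` at `u_t`. If that form is at most `κ‖g‖²`, Grönwall gives `‖u_t‖ ≤ e^{κt}`
(`integral_feynmanKac_sq_le`). Neither symmetry of the semigroup nor regularity of the paths enters:
the continuity needed comes from joint measurability, stationarity and continuity of translations in
`L¹`.

The form bound for `lW` is `form_le_of_strongFSobolev`. Write `g = a + b h` with `h` centred and of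
unit norm, and `S = ∫ G(h²) dμ`. The Sobolev inequality supplies a dissipation of at least `b² S /
C`. Half of it absorbs `l b² ∫ |W| h²`, by the Hölder-Young inequality for the gauge norm; this is
where `l ≤ λ₂` is needed. The other half absorbs the cross term `2 l a b ∫ W h` up to `(2 m² C /
G(1)) l² a²`, because `S ≥ G(1)`.

A general `V` is truncated. Truncations need not be centred, which costs an extra rate `l |∫ V_n
dμ|` tending to `0`, and Fatou's lemma passes to the limit. Cauchy-Schwarz for `dν/dμ`, Markov's
inequality and the supremum over `l` finish. -/

/-! ## Real analysis -/

theorem intervalIntegrable_of_bounded {g : ℝ → ℝ} (hg : Measurable g) {K : ℝ}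
    (hK : ∀ s, |g s| ≤ K) (a b : ℝ) : IntervalIntegrable g volume a b := by
  rw [intervalIntegrable_iff]
  exact Measure.integrableOn_of_bounded (M := K) (by simp)
    hg.aestronglyMeasurable (Eventually.of_forall hK)

theorem abs_intervalIntegral_le {g : ℝ → ℝ} {K : ℝ}
    (hK : ∀ s, |g s| ≤ K) (a b : ℝ) : |∫ s in a..b, g s| ≤ K * |b - a| := by
  rw [← Real.norm_eq_abs]
  exact intervalIntegral.norm_integral_le_of_norm_le_const fun s _ => hK s

/-- The fundamental theorem of calculus for a `C¹` function of an indefinite integral. -/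
theorem comp_integral_sub_eq {g : ℝ → ℝ} (hg : Measurable g) {K : ℝ}
    (hK : ∀ s, |g s| ≤ K) {Φ : ℝ → ℝ} (hΦ : ContDiff ℝ 1 Φ) (c a b : ℝ) :
    Φ (c + ∫ s in a..b, g s) - Φ c
      = ∫ t in a..b, deriv Φ (c + ∫ s in a..t, g s) * g t := by
  set J : ℝ → ℝ := fun t => c + ∫ s in a..t, g s with hJ
  have hK0 : 0 ≤ K := (abs_nonneg _).trans (hK 0)
  have hJL : LipschitzWith K.toNNReal J := by
    refine LipschitzWith.of_dist_le_mul fun x y => ?_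
    rw [Real.dist_eq, Real.dist_eq, hJ, Real.coe_toNNReal _ hK0]
    have := intervalIntegral.integral_interval_sub_left
      (intervalIntegrable_of_bounded hg hK a x) (intervalIntegrable_of_bounded hg hK a y)
    simp only [add_sub_add_left_eq_sub, this]
    exact abs_intervalIntegral_le hK y x
  -- Since `g` is only measurable, `J` is differentiable merely almost everywhere; absolute
  -- continuity of `Φ ∘ J`, which is Lipschitz on the compact interval, makes this enough.
  have hJd : ∀ᵐ t, HasDerivAt J (g t) t := by
    have hloc : LocallyIntegrable g volume := by
      intro x
      refine ⟨Set.Icc (x - 1) (x + 1), Icc_mem_nhds (by linarith) (by linarith), ?_⟩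
      exact Measure.integrableOn_of_bounded (M := K) (by simp)
        hg.aestronglyMeasurable (Eventually.of_forall hK)
    filter_upwards [LocallyIntegrable.ae_hasDerivAt_integral hloc] with t ht
    exact (ht a).const_add c
  have hac : AbsolutelyContinuousOnInterval (Φ ∘ J) a b := by
    obtain ⟨B, hB⟩ := (isCompact_uIcc (a := a) (b := b)).image hJL.continuous
      |>.isBounded.subset_closedBall 0
    have hcomp : IsCompact (Metric.closedBall (0 : ℝ) B) := isCompact_closedBall _ _
    obtain ⟨D, hD⟩ := (hcomp.image (hΦ.continuous_deriv le_rfl)).isBounded.subset_closedBall 0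
    have hΦL : LipschitzOnWith D.toNNReal Φ (Metric.closedBall 0 B) := by
      refine (convex_closedBall 0 B).lipschitzOnWith_of_nnnorm_deriv_le
        (fun x _ => (hΦ.differentiable one_ne_zero) x) fun x hx => ?_
      have := hD (Set.mem_image_of_mem _ hx)
      rw [mem_closedBall_zero_iff] at this
      rw [← NNReal.coe_le_coe, coe_nnnorm]
      exact this.trans (Real.le_coe_toNNReal _)
    have : LipschitzOnWith (D.toNNReal * K.toNNReal) (Φ ∘ J) (Set.uIcc a b) :=
      hΦL.comp (hJL.lipschitzOnWith) (fun x hx => hB (Set.mem_image_of_mem _ hx))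
    exact this.absolutelyContinuousOnInterval
  have h1 := hac.integral_deriv_eq_sub
  have h2 : J a = c := by simp [hJ]
  have h3 : ∫ t in a..b, deriv (Φ ∘ J) t = ∫ t in a..b, deriv Φ (J t) * g t := by
    refine intervalIntegral.integral_congr_ae ?_
    filter_upwards [hJd] with t ht _
    exact (((hΦ.differentiable one_ne_zero) (J t)).hasDerivAt.comp t ht).deriv
  rw [← h3, h1, Function.comp, Function.comp, h2]

/-- Continuity of translations in `L¹`, for bounded functions on the unit interval. -/
theorem tendsto_integral_abs_translate_sub {g : ℝ → ℝ} (hg : Measurable g) {K : ℝ}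
    (hK : ∀ s, |g s| ≤ K) :
    Tendsto (fun h : ℝ => ∫ s in (0 : ℝ)..1, |g (s + h) - g s|) (𝓝 0) (𝓝 0) := by
  -- The window contains both `s` and `s + h` for `s ∈ [0, 1]` and `|h| < 1`, so the cut-off does
  -- not change the integral while making the function integrable on `ℝ`.
  set G : ℝ → ℝ := (Set.Icc (-1 : ℝ) 2).indicator g with hG
  have hGi : Integrable G volume := by
    rw [hG, integrable_indicator_iff measurableSet_Icc]
    exact Measure.integrableOn_of_bounded (M := K) (by simp)
      hg.aestronglyMeasurable (Eventually.of_forall hK)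
  have hGm : MemLp G 1 volume := memLp_one_iff_integrable.2 hGi
  set f : Lp ℝ 1 (volume : Measure ℝ) := hGm.toLp G with hf
  have : Fact ((1 : ℝ≥0∞) ≠ ∞) := ⟨ENNReal.one_ne_top⟩
  have hc : Continuous fun h : ℝ => DomAddAct.mk h +ᵥ f :=
    (DomAddAct.continuous_mk).vadd continuous_const
  have ht : Tendsto (fun h : ℝ => ‖(DomAddAct.mk h +ᵥ f) - f‖) (𝓝 0) (𝓝 0) := by
    have := ((hc.sub continuous_const).norm (E := Lp ℝ 1 (volume : Measure ℝ))).tendsto (0 : ℝ)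
      (f := fun h : ℝ => ‖(DomAddAct.mk h +ᵥ f) - f‖)
    simpa using this
  have heq : ∀ h : ℝ, ‖(DomAddAct.mk h +ᵥ f) - f‖ = ∫ s, |G (s + h) - G s| := by
    intro h
    rw [L1.norm_eq_integral_norm]
    refine integral_congr_ae ?_
    have e1 := DomAddAct.vadd_Lp_ae_eq (DomAddAct.mk h) f
    have e2 : (f : ℝ → ℝ) =ᵐ[volume] G := hGm.coeFn_toLp
    have e3 : (fun s => f (h + s)) =ᵐ[volume] fun s => G (h + s) :=
      (measurePreserving_add_left volume h).quasiMeasurePreserving.ae_eq_comp e2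
    filter_upwards [e1, e2, e3, Lp.coeFn_sub (DomAddAct.mk h +ᵥ f) f] with s h1 h2 h3 h4
    rw [h4, Pi.sub_apply, h1, h2, Real.norm_eq_abs]
    rw [add_comm s h, ← h3]
    rfl
  refine squeeze_zero' (g := fun h => ∫ s, |G (s + h) - G s|) ?_ ?_ ?_
  · exact Eventually.of_forall fun h =>
      intervalIntegral.integral_nonneg zero_le_one fun _ _ => abs_nonneg _
  · filter_upwards [Ioo_mem_nhds (show (-1 : ℝ) < 0 by norm_num) (show (0 : ℝ) < 1 by norm_num)]
      with h hh
    have hint : Integrable (fun s => |G (s + h) - G s|) volume :=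
      ((hGi.comp_add_right h).sub hGi).abs
    calc ∫ s in (0 : ℝ)..1, |g (s + h) - g s| = ∫ s in (0 : ℝ)..1, |G (s + h) - G s| := by
          refine intervalIntegral.integral_congr fun s hs => ?_
          rw [Set.uIcc_of_le zero_le_one] at hs
          have i1 : s ∈ Set.Icc (-1 : ℝ) 2 := ⟨by linarith [hs.1], by linarith [hs.2]⟩
          have i2 : s + h ∈ Set.Icc (-1 : ℝ) 2 :=
            ⟨by linarith [hs.1, hh.1], by linarith [hs.2, hh.2]⟩
          simp only [hG, Set.indicator_of_mem i1, Set.indicator_of_mem i2]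
      _ ≤ ∫ s, |G (s + h) - G s| := by
          rw [intervalIntegral.integral_of_le zero_le_one]
          exact setIntegral_le_integral hint (Eventually.of_forall fun _ => abs_nonneg _)
  · simpa only [heq] using ht

/-- Grönwall's inequality in integral form. -/
theorem le_exp_of_le_add_integral {φ : ℝ → ℝ} (hφ : Continuous φ) {A L T : ℝ} (hL : 0 ≤ L)
    (hT : 0 ≤ T) (h : ∀ t ∈ Set.Icc 0 T, φ t ≤ A + L * ∫ s in (0 : ℝ)..t, φ s) :
    φ T ≤ A * Real.exp (L * T) := by
  -- Integrating factor: the hypothesis says exactly that `Ψ' ≤ 0` on the interval.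
  set Ψ : ℝ → ℝ := fun t => (A + L * ∫ s in (0 : ℝ)..t, φ s) * Real.exp (-(L * t)) with hΨ
  have hd : ∀ t, HasDerivAt Ψ ((L * φ t) * Real.exp (-(L * t))
      + (A + L * ∫ s in (0 : ℝ)..t, φ s) * (Real.exp (-(L * t)) * (-(L * 1)))) t := by
    intro t
    have h1 : HasDerivAt (fun t => ∫ s in (0 : ℝ)..t, φ s) (φ t) t :=
      intervalIntegral.integral_hasDerivAt_right (hφ.intervalIntegrable _ _)
        hφ.stronglyMeasurable.stronglyMeasurableAtFilter hφ.continuousAt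
    exact ((h1.const_mul L).const_add A).mul (((hasDerivAt_id t).const_mul L).neg.exp)
  have hanti : AntitoneOn Ψ (Set.Icc 0 T) := by
    refine antitoneOn_of_deriv_nonpos (convex_Icc 0 T)
      (fun t _ => (hd t).continuousAt.continuousWithinAt)
      (fun t _ => (hd t).differentiableAt.differentiableWithinAt) fun t ht => ?_
    rw [interior_Icc] at ht
    rw [(hd t).deriv]
    have h1 := mul_le_mul_of_nonneg_left (h t (Set.Ioo_subset_Icc_self ht)) hL
    have h2 := (Real.exp_pos (-(L * t))).le
    nlinarith [mul_le_mul_of_nonneg_right h1 h2]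
  have h0 : Ψ T ≤ Ψ 0 := hanti (Set.left_mem_Icc.2 hT) (Set.right_mem_Icc.2 hT) hT
  have h1 : Ψ 0 = A := by simp [hΨ]
  rw [h1, hΨ] at h0
  simp only [Real.exp_neg] at h0
  rw [← div_eq_mul_inv, div_le_iff₀ (Real.exp_pos _)] at h0
  exact (h T (Set.right_mem_Icc.2 hT)).trans h0

/-! ## Measure theory of bounded functions -/

theorem integrable_of_abs_le {α : Type*} [MeasurableSpace α] {Q : Measure α} [IsFiniteMeasure Q]
    {f : α → ℝ} (hf : Measurable f) {B : ℝ} (hB : ∀ x, |f x| ≤ B) : Integrable f Q :=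
  Integrable.of_bound hf.aestronglyMeasurable B (Eventually.of_forall hB)

theorem abs_integral_le_of_abs_le {α : Type*} [MeasurableSpace α] {Q : Measure α}
    [IsProbabilityMeasure Q] {f : α → ℝ} {B : ℝ} (hB : ∀ x, |f x| ≤ B) :
    |∫ x, f x ∂Q| ≤ B := by
  have h : ∀ x, ‖f x‖ ≤ B := hB
  simpa using norm_integral_le_of_norm_le_const (μ := Q) (Eventually.of_forall h)

theorem integral_bind_eq {α β : Type*} [MeasurableSpace α] [MeasurableSpace β] {μ : Measure α}
    [SFinite μ] {κ : Kernel α β} [IsSFiniteKernel κ] {f : β → ℝ} (hf : Integrable f (μ.bind κ)) :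
    ∫ y, f y ∂(μ.bind κ) = ∫ x, ∫ y, f y ∂(κ x) ∂μ := by
  rw [Measure.comp_eq_comp_const_apply] at hf ⊢
  simpa using Kernel.integral_comp hf

theorem measurable_integral_kernel_prod {S α β : Type*} [MeasurableSpace S] [MeasurableSpace α]
    [MeasurableSpace β] {κ : Kernel α β} [IsSFiniteKernel κ] {F : S × β → ℝ} (hF : Measurable F) :
    Measurable fun p : S × α => ∫ y, F (p.1, y) ∂(κ p.2) := by
  have h : Measurable fun q : (S × α) × β => F (q.1.1, q.2) :=
    hF.comp (by fun_prop)
  have := (h.stronglyMeasurable).integral_kernel_prod_right' (κ := κ.prodMkLeft S)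
  simpa using this.measurable

theorem measurable_integral_prod {S β : Type*} [MeasurableSpace S]
    [MeasurableSpace β] {Q : Measure β} [SFinite Q] {F : S × β → ℝ} (hF : Measurable F) :
    Measurable fun s : S => ∫ y, F (s, y) ∂Q :=
  hF.stronglyMeasurable.integral_prod_right'.measurable

theorem integral_intervalIntegral_comm {Ω : Type*} [MeasurableSpace Ω] {Q : Measure Ω}
    [IsFiniteMeasure Q] {F : ℝ → Ω → ℝ} (hF : Measurable fun p : ℝ × Ω => F p.1 p.2) {B : ℝ}
    {a b : ℝ} (hab : a ≤ b) (hB : ∀ r ∈ Set.Ioc a b, ∀ ω, |F r ω| ≤ B) :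
    ∫ ω, (∫ r in a..b, F r ω) ∂Q = ∫ r in a..b, (∫ ω, F r ω ∂Q) := by
  simp only [intervalIntegral.integral_of_le hab]
  refine integral_integral_swap (f := fun ω r => F r ω) ?_
  refine Integrable.of_bound (C := B) (hF.comp measurable_swap).aestronglyMeasurable ?_
  have : ∀ᵐ r ∂(volume.restrict (Set.Ioc a b)), r ∈ Set.Ioc a b :=
    ae_restrict_mem measurableSet_Ioc
  have h2 := (Measure.quasiMeasurePreserving_snd (μ := Q)
    (ν := volume.restrict (Set.Ioc a b))).ae this
  filter_upwards [h2] with p hp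
  exact hB _ hp _

/-- The indefinite integral of a jointly measurable bounded function is jointly measurable. -/
theorem measurable_intervalIntegral_prod {Ω : Type*} [MeasurableSpace Ω] {F : ℝ × Ω → ℝ}
    (hF : Measurable F) :
    Measurable fun p : (ℝ × ℝ) × Ω => ∫ r in p.1.1..p.1.2, F (r, p.2) := by
  have key : ∀ u v : (ℝ × ℝ) × Ω → ℝ, Measurable u → Measurable v →
      Measurable fun p : (ℝ × ℝ) × Ω => ∫ r in Set.Ioc (u p) (v p), F (r, p.2) := by
    intro u v hu hv
    have hs : MeasurableSet {q : ((ℝ × ℝ) × Ω) × ℝ | u q.1 < q.2 ∧ q.2 ≤ v q.1} :=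
      (measurableSet_lt (hu.comp measurable_fst) measurable_snd).inter
        (measurableSet_le measurable_snd (hv.comp measurable_fst))
    have hm : Measurable ({q : ((ℝ × ℝ) × Ω) × ℝ | u q.1 < q.2 ∧ q.2 ≤ v q.1}.indicator
        fun q => F (q.2, q.1.2)) := (hF.comp (by fun_prop)).indicator hs
    have := measurable_integral_prod (Q := volume) hm
    convert this using 2 with p
    rw [← integral_indicator measurableSet_Ioc]
    rfl
  have h1 := (key (fun p => p.1.1) (fun p => p.1.2) (by fun_prop) (by fun_prop)).sub
    (key (fun p => p.1.2) (fun p => p.1.1) (by fun_prop) (by fun_prop))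
  exact h1

namespace MarkovProcess

variable {E Ω : Type*} [MeasurableSpace E] [MeasurableSpace Ω]

instance (M : MarkovProcess E Ω) : IsMarkovKernel M.law := M.isMarkov_law

/-! ## The semigroup on bounded functions -/

theorem semigroup_eq_integral_law (M : MarkovProcess E Ω) (t : ℝ≥0) {f : E → ℝ}
    (hf : Measurable f) (x : E) : M.semigroup t f x = ∫ ω, f (M.X t ω) ∂(M.law x) := by
  rw [semigroup, transition, Kernel.map_apply _ (M.measurable_X_at t),
    integral_map (M.measurable_X_at t).aemeasurable hf.aestronglyMeasurable]

theorem measurable_semigroup_prod (M : MarkovProcess E Ω) {f : E → ℝ} (hf : Measurable f) :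
    Measurable fun p : ℝ≥0 × E => M.semigroup p.1 f p.2 := by
  simp only [M.semigroup_eq_integral_law _ hf]
  exact measurable_integral_kernel_prod (F := fun q : ℝ≥0 × Ω => f (M.X q.1 q.2))
    (hf.comp M.measurable_X)

theorem measurable_semigroup (M : MarkovProcess E Ω) (t : ℝ≥0) {f : E → ℝ} (hf : Measurable f) :
    Measurable (M.semigroup t f) :=
  (M.measurable_semigroup_prod hf).comp measurable_prodMk_left

theorem abs_semigroup_le (M : MarkovProcess E Ω) (t : ℝ≥0) {f : E → ℝ} {B : ℝ}
    (hB : ∀ x, |f x| ≤ B) (x : E) : |M.semigroup t f x| ≤ B :=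
  abs_integral_le_of_abs_le hB

theorem integral_semigroup (M : MarkovProcess E Ω) {μ : Measure E} [IsProbabilityMeasure μ]
    (hμ : M.IsInvariant μ) (t : ℝ≥0) {f : E → ℝ} (hf : Integrable f μ) :
    ∫ x, M.semigroup t f x ∂μ = ∫ x, f x ∂μ := by
  have h : μ.bind (M.transition t) = μ := hμ t
  conv_rhs => rw [← h]
  rw [integral_bind_eq (by rwa [h])]
  rfl

/-! ## The simple Markov property of a process -/

/-- The natural filtration of the process `Y`. -/
abbrev past (Y : ℝ≥0 → Ω → E) (s : ℝ≥0) : MeasurableSpace Ω :=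
  ⨆ u : ℝ≥0, ⨆ _ : u ≤ s, MeasurableSpace.comap (Y u) inferInstance

/-- Under `Q`, the process `Y` has the Markov property with the transition kernels of `M`. -/
structure IsMarkovUnder (M : MarkovProcess E Ω) (Y : ℝ≥0 → Ω → E) (Q : Measure Ω) : Prop where
  measurable : Measurable fun p : ℝ≥0 × Ω => Y p.1 p.2
  markov : ∀ (s t : ℝ≥0) (A : Set Ω) (B : Set E), MeasurableSet[past Y s] A → MeasurableSet B →
    Q (A ∩ {ω | Y (s + t) ω ∈ B}) = ∫⁻ ω in A, M.transition t (Y s ω) B ∂Q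

theorem past_le {Y : ℝ≥0 → Ω → E} (hY : Measurable fun p : ℝ≥0 × Ω => Y p.1 p.2) (s : ℝ≥0) :
    past Y s ≤ inferInstanceAs (MeasurableSpace Ω) :=
  iSup₂_le fun u _ => (hY.comp (measurable_prodMk_left (x := u))).comap_le

theorem measurable_past (Y : ℝ≥0 → Ω → E) {r s : ℝ≥0} (hrs : r ≤ s) :
    Measurable[past Y s] (Y r) :=
  measurable_iff_comap_le.2 (le_iSup₂_of_le r hrs le_rfl)

namespace IsMarkovUnder

variable {M : MarkovProcess E Ω} {Y : ℝ≥0 → Ω → E} {Q : Measure Ω}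

theorem measurable_at (h : M.IsMarkovUnder Y Q) (t : ℝ≥0) : Measurable (Y t) :=
  h.measurable.comp measurable_prodMk_left

theorem measurable_real (h : M.IsMarkovUnder Y Q) :
    Measurable fun p : ℝ × Ω => Y p.1.toNNReal p.2 :=
  h.measurable.comp ((measurable_real_toNNReal.comp measurable_fst).prodMk measurable_snd)

/-- The Markov property on events, read as an equality of measures on `E`; integrals of bounded
functions then follow without approximation by simple functions. -/
theorem map_restrict [IsProbabilityMeasure Q] (h : M.IsMarkovUnder Y Q) (s t : ℝ≥0) {A : Set Ω}
    (hA : MeasurableSet[past Y s] A) :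
    (Q.restrict A).map (Y (s + t)) = ((Q.restrict A).map (Y s)).bind (M.transition t) := by
  have hA' : MeasurableSet A := past_le h.measurable s A hA
  ext B hB
  rw [Measure.map_apply (h.measurable_at _) hB, Measure.restrict_apply (h.measurable_at _ hB),
    Measure.bind_apply hB (M.transition t).measurable.aemeasurable,
    lintegral_map ((M.transition t).measurable_coe hB) (h.measurable_at s), Set.inter_comm]
  exact h.markov s t A B hA hB

theorem setIntegral_eq [IsProbabilityMeasure Q] (h : M.IsMarkovUnder Y Q) (s t : ℝ≥0) {A : Set Ω}
    (hA : MeasurableSet[past Y s] A) {f : E → ℝ} (hf : Measurable f) {B : ℝ}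
    (hB : ∀ x, |f x| ≤ B) :
    ∫ ω in A, f (Y (s + t) ω) ∂Q = ∫ ω in A, M.semigroup t f (Y s ω) ∂Q := by
  rw [← integral_map (h.measurable_at _).aemeasurable hf.aestronglyMeasurable,
    h.map_restrict s t hA, integral_bind_eq (integrable_of_abs_le hf hB),
    integral_map (h.measurable_at _).aemeasurable]
  · rfl
  · exact (M.measurable_semigroup t hf).aestronglyMeasurable

theorem integral_eq [IsProbabilityMeasure Q] (h : M.IsMarkovUnder Y Q) (s t : ℝ≥0)
    {f : E → ℝ} (hf : Measurable f) {B : ℝ} (hB : ∀ x, |f x| ≤ B) :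
    ∫ ω, f (Y (s + t) ω) ∂Q = ∫ ω, M.semigroup t f (Y s ω) ∂Q := by
  simpa using h.setIntegral_eq s t (A := Set.univ) MeasurableSet.univ hf hB

theorem integral_mul_eq [IsProbabilityMeasure Q] (h : M.IsMarkovUnder Y Q) (s t : ℝ≥0) {Z : Ω → ℝ}
    (hZ : Measurable[past Y s] Z) {D : ℝ} (hD : ∀ ω, |Z ω| ≤ D) {f : E → ℝ} (hf : Measurable f)
    {B : ℝ} (hB : ∀ x, |f x| ≤ B) :
    ∫ ω, Z ω * f (Y (s + t) ω) ∂Q = ∫ ω, Z ω * M.semigroup t f (Y s ω) ∂Q := by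
  have hm := past_le h.measurable s
  have hZ' : Measurable Z := hZ.mono hm le_rfl
  have hfY : Measurable fun ω => f (Y (s + t) ω) := hf.comp (h.measurable_at _)
  have hPY : Measurable fun ω => M.semigroup t f (Y s ω) :=
    (M.measurable_semigroup t hf).comp (h.measurable_at _)
  have hi : Integrable (fun ω => f (Y (s + t) ω)) Q := integrable_of_abs_le hfY fun _ => hB _
  -- The set identities characterise the conditional expectation given the past, from which the
  -- past-measurable factor `Z` can be pulled out.
  have hc : (fun ω => M.semigroup t f (Y s ω)) =ᵐ[Q] Q[fun ω => f (Y (s + t) ω) | past Y s] := by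
    refine ae_eq_condExp_of_forall_setIntegral_eq hm hi
      (fun A _ _ => (integrable_of_abs_le hPY fun _ => M.abs_semigroup_le t hB _).integrableOn)
      (fun A hA _ => (h.setIntegral_eq s t hA hf hB).symm) ?_
    have : Measurable[past Y s] fun ω => M.semigroup t f (Y s ω) :=
      (M.measurable_semigroup t hf).comp (measurable_past Y le_rfl)
    exact this.stronglyMeasurable.aestronglyMeasurable
  have hp := condExp_mul_of_stronglyMeasurable_left (μ := Q) (m := past Y s)
    (f := Z) (g := fun ω => f (Y (s + t) ω)) hZ.stronglyMeasurable
    (integrable_of_abs_le (B := D * B) (hZ'.mul hfY) fun ω => by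
      rw [Pi.mul_apply, abs_mul]
      exact mul_le_mul (hD ω) (hB _) (abs_nonneg _) ((abs_nonneg _).trans (hD ω))) hi
  calc ∫ ω, Z ω * f (Y (s + t) ω) ∂Q
      = ∫ ω, (Q[Z * fun ω => f (Y (s + t) ω) | past Y s]) ω ∂Q := (integral_condExp hm).symm
    _ = ∫ ω, Z ω * M.semigroup t f (Y s ω) ∂Q := by
        refine integral_congr_ae ?_
        filter_upwards [hp, hc] with ω h1 h2
        rw [h1, Pi.mul_apply, h2]

end IsMarkovUnder

end MarkovProcess

namespace MarkovProcess

variable {E Ω : Type*} [MeasurableSpace E] [MeasurableSpace Ω]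

/-! ## Additive functionals -/

/-- The additive functional `∫_a^b W(Y_r) dr`. -/
noncomputable def additive (W : E → ℝ) (Y : ℝ≥0 → Ω → E) (a b : ℝ) (ω : Ω) : ℝ :=
  ∫ r in a..b, W (Y r.toNNReal ω)

theorem measurable_additive_prod {W : E → ℝ} (hW : Measurable W) {Y : ℝ≥0 → Ω → E}
    (hY : Measurable fun p : ℝ≥0 × Ω => Y p.1 p.2) :
    Measurable fun p : (ℝ × ℝ) × Ω => additive W Y p.1.1 p.1.2 p.2 :=
  measurable_intervalIntegral_prod (F := fun p : ℝ × Ω => W (Y p.1.toNNReal p.2))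
    (hW.comp (hY.comp ((measurable_real_toNNReal.comp measurable_fst).prodMk measurable_snd)))

theorem measurable_additive {W : E → ℝ} (hW : Measurable W) {Y : ℝ≥0 → Ω → E}
    (hY : Measurable fun p : ℝ≥0 × Ω => Y p.1 p.2) (a b : ℝ) :
    Measurable (additive W Y a b) :=
  (measurable_additive_prod hW hY).comp (measurable_prodMk_left (x := (a, b)))

theorem measurable_path {W : E → ℝ} (hW : Measurable W) {Y : ℝ≥0 → Ω → E}
    (hY : Measurable fun p : ℝ≥0 × Ω => Y p.1 p.2) (ω : Ω) :
    Measurable fun r : ℝ => W (Y r.toNNReal ω) :=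
  hW.comp (hY.comp (measurable_real_toNNReal.prodMk measurable_const))

theorem abs_additive_le {W : E → ℝ} {K : ℝ} (hK : ∀ x, |W x| ≤ K) (Y : ℝ≥0 → Ω → E)
    {a b : ℝ} (hab : a ≤ b) (ω : Ω) : |additive W Y a b ω| ≤ K * (b - a) := by
  have := abs_intervalIntegral_le (g := fun r => W (Y r.toNNReal ω)) (fun r => hK _) a b
  rwa [abs_of_nonneg (sub_nonneg.2 hab)] at this

theorem exp_additive_le {W : E → ℝ} {K : ℝ} (hK : ∀ x, |W x| ≤ K) (Y : ℝ≥0 → Ω → E)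
    {a b : ℝ} (hab : a ≤ b) (ω : Ω) :
    |Real.exp (additive W Y a b ω)| ≤ Real.exp (K * (b - a)) := by
  rw [Real.abs_exp]
  exact Real.exp_le_exp.2 ((le_abs_self _).trans (abs_additive_le hK Y hab ω))

theorem exp_additive_eq {W : E → ℝ} (hW : Measurable W) {K : ℝ} (hK : ∀ x, |W x| ≤ K)
    {Y : ℝ≥0 → Ω → E} (hY : Measurable fun p : ℝ≥0 × Ω => Y p.1 p.2) (t : ℝ) (ω : Ω) :
    Real.exp (additive W Y 0 t ω) =
      1 + ∫ s in (0 : ℝ)..t, Real.exp (additive W Y 0 s ω) * W (Y s.toNNReal ω) := by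
  have := comp_integral_sub_eq (measurable_path hW hY ω) (fun r => hK _) Real.contDiff_exp 0 0 t
  simp only [Real.deriv_exp, zero_add, Real.exp_zero] at this
  simp only [additive]
  linarith

namespace IsMarkovUnder

variable {M : MarkovProcess E Ω} {Y : ℝ≥0 → Ω → E} {Q : Measure Ω}

/-- Joint measurability of the process does not make `∫_0^s W(Y_r) dr` measurable for its natural
filtration, so the Markov property cannot be applied to it directly. By Fubini its powers are
integrals of products of values `W(Y_r)` with `r ≤ s`, each of which is past-measurable. -/
theorem integral_mul_additive_pow_mul_eq_zero [IsProbabilityMeasure Q] (h : M.IsMarkovUnder Y Q)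
    {W : E → ℝ} (hW : Measurable W) {K : ℝ} (hK : ∀ x, |W x| ≤ K)
    {f : E → ℝ} (hf : Measurable f) {B : ℝ} (hB : ∀ x, |f x| ≤ B) (s t : ℝ≥0) (n : ℕ)
    (Z : Ω → ℝ) (hZ : Measurable[past Y s] Z) (D : ℝ) (hD : ∀ ω, |Z ω| ≤ D) :
    ∫ ω, Z ω * additive W Y 0 s ω ^ n * (f (Y (s + t) ω) - M.semigroup t f (Y s ω)) ∂Q = 0 := by
  have hfY : Measurable fun ω => f (Y (s + t) ω) := hf.comp (h.measurable_at _)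
  have hPY : Measurable fun ω => M.semigroup t f (Y s ω) :=
    (M.measurable_semigroup t hf).comp (h.measurable_at _)
  induction n generalizing Z D with
  | zero =>
    have hZ' : Measurable Z := hZ.mono (past_le h.measurable s) le_rfl
    have hb : ∀ {g : Ω → ℝ}, (∀ ω, |g ω| ≤ B) → ∀ ω, |Z ω * g ω| ≤ D * B := fun hg ω => by
      rw [abs_mul]
      exact mul_le_mul (hD ω) (hg ω) (abs_nonneg _) ((abs_nonneg _).trans (hD ω))
    simp only [pow_zero, mul_one, mul_sub]
    have i1 : Integrable (fun ω => Z ω * f (Y (s + t) ω)) Q :=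
      integrable_of_abs_le (hZ'.mul hfY) (hb fun _ => hB _)
    have i2 : Integrable (fun ω => Z ω * M.semigroup t f (Y s ω)) Q :=
      integrable_of_abs_le (hZ'.mul hPY) (hb fun _ => M.abs_semigroup_le t hB _)
    rw [integral_sub i1 i2, h.integral_mul_eq s t hZ hD hf hB, sub_self]
  | succ n ih =>
    have hZ' : Measurable Z := hZ.mono (past_le h.measurable s) le_rfl
    set G : Ω → ℝ := fun ω =>
      additive W Y 0 s ω ^ n * (f (Y (s + t) ω) - M.semigroup t f (Y s ω)) with hG
    have hGm : Measurable G := ((measurable_additive hW h.measurable 0 s).pow_const n).mul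
      (hfY.sub hPY)
    have hGb : ∀ ω, |G ω| ≤ (K * (s - 0)) ^ n * (B + B) := fun ω => by
      rw [hG, abs_mul, abs_pow]
      have h1 := abs_additive_le hK Y s.coe_nonneg ω
      have h2 := (abs_sub (f (Y (s + t) ω)) (M.semigroup t f (Y s ω))).trans
        (add_le_add (hB _) (M.abs_semigroup_le t hB _))
      exact mul_le_mul (pow_le_pow_left₀ (abs_nonneg _) h1 n) h2 (abs_nonneg _)
        (pow_nonneg ((abs_nonneg _).trans h1) n)
    have hpath : ∀ ω, Z ω * additive W Y 0 s ω ^ (n + 1) *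
        (f (Y (s + t) ω) - M.semigroup t f (Y s ω))
        = ∫ r in (0 : ℝ)..s, Z ω * W (Y r.toNNReal ω) * G ω := fun ω => by
      rw [intervalIntegral.integral_mul_const, intervalIntegral.integral_const_mul]
      simp only [hG, additive]
      ring
    simp only [hpath]
    rw [integral_intervalIntegral_comm
      (F := fun r ω => Z ω * W (Y r.toNNReal ω) * G ω)
      (((hZ'.comp measurable_snd).mul (hW.comp h.measurable_real)).mul (hGm.comp measurable_snd))
      (B := D * K * ((K * (s - 0)) ^ n * (B + B))) s.coe_nonneg]
    · refine intervalIntegral.integral_zero_ae (Eventually.of_forall fun r hr => ?_)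
      rw [Set.uIoc_of_le s.coe_nonneg] at hr
      have hrs : r.toNNReal ≤ s := Real.toNNReal_le_iff_le_coe.2 hr.2
      -- One factor of the power has become an integral over `r`; for fixed `r ≤ s` the value
      -- `W(Y_r)` is absorbed into `Z`, which is why the induction runs over all `Z`.
      have := ih (fun ω => Z ω * W (Y r.toNNReal ω)) (hZ.mul (hW.comp (measurable_past Y hrs)))
        (D * K) fun ω => by
          rw [abs_mul]
          exact mul_le_mul (hD ω) (hK _) (abs_nonneg _) ((abs_nonneg _).trans (hD ω))
      simpa only [hG, mul_assoc] using this
    · intro r _ ω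
      have hDK : |Z ω * W (Y r.toNNReal ω)| ≤ D * K := by
        rw [abs_mul]
        exact mul_le_mul (hD ω) (hK _) (abs_nonneg _) ((abs_nonneg _).trans (hD ω))
      rw [abs_mul]
      exact mul_le_mul hDK (hGb ω) (abs_nonneg _) ((abs_nonneg _).trans hDK)

/-- The Markov property for exponentials of additive functionals of the past. -/
theorem integral_mul_exp_additive_mul_eq [IsProbabilityMeasure Q] (h : M.IsMarkovUnder Y Q)
    {W : E → ℝ} (hW : Measurable W) {K : ℝ} (hK : ∀ x, |W x| ≤ K)
    {f : E → ℝ} (hf : Measurable f) {B : ℝ} (hB : ∀ x, |f x| ≤ B) (s t : ℝ≥0)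
    {Z : Ω → ℝ} (hZ : Measurable[past Y s] Z) {D : ℝ} (hD : ∀ ω, |Z ω| ≤ D) :
    ∫ ω, Z ω * Real.exp (additive W Y 0 s ω) * f (Y (s + t) ω) ∂Q =
      ∫ ω, Z ω * Real.exp (additive W Y 0 s ω) * M.semigroup t f (Y s ω) ∂Q := by
  have hfY : Measurable fun ω => f (Y (s + t) ω) := hf.comp (h.measurable_at _)
  have hPY : Measurable fun ω => M.semigroup t f (Y s ω) :=
    (M.measurable_semigroup t hf).comp (h.measurable_at _)
  have hZ' : Measurable Z := hZ.mono (past_le h.measurable s) le_rfl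
  have hI := measurable_additive hW h.measurable 0 s
  have hZe : Measurable fun ω => Z ω * Real.exp (additive W Y 0 s ω) :=
    hZ'.mul (Real.measurable_exp.comp hI)
  have hZb : ∀ ω, |Z ω * Real.exp (additive W Y 0 s ω)| ≤ D * Real.exp (K * (s - 0)) := fun ω => by
    rw [abs_mul]
    exact mul_le_mul (hD ω) (exp_additive_le hK Y s.coe_nonneg ω) (abs_nonneg _)
      ((abs_nonneg _).trans (hD ω))
  have hb : ∀ {g : Ω → ℝ}, (∀ ω, |g ω| ≤ B) → ∀ ω,
      |Z ω * Real.exp (additive W Y 0 s ω) * g ω| ≤ D * Real.exp (K * (s - 0)) * B :=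
    fun hg ω => by
      rw [abs_mul]
      exact mul_le_mul (hZb ω) (hg ω) (abs_nonneg _) ((abs_nonneg _).trans (hZb ω))
  have i1 : Integrable (fun ω => Z ω * Real.exp (additive W Y 0 s ω) * f (Y (s + t) ω)) Q :=
    integrable_of_abs_le (hZe.mul hfY) (hb fun _ => hB _)
  have i2 : Integrable (fun ω => Z ω * Real.exp (additive W Y 0 s ω) *
      M.semigroup t f (Y s ω)) Q :=
    integrable_of_abs_le (hZe.mul hPY) (hb fun _ => M.abs_semigroup_le t hB _)
  rw [← sub_eq_zero, ← integral_sub i1 i2]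
  -- Expanding the exponential in powers of the additive functional reduces the claim to the
  -- previous lemma, term by term.
  have hs : HasSum (fun n : ℕ => ∫ ω, ((n.factorial : ℝ)⁻¹ * (Z ω * additive W Y 0 s ω ^ n *
      (f (Y (s + t) ω) - M.semigroup t f (Y s ω)))) ∂Q)
      (∫ ω, (Z ω * Real.exp (additive W Y 0 s ω) * f (Y (s + t) ω) -
        Z ω * Real.exp (additive W Y 0 s ω) * M.semigroup t f (Y s ω)) ∂Q) := by
    refine hasSum_integral_of_dominated_convergence
      (fun n _ => (n.factorial : ℝ)⁻¹ * (D * (K * (s - 0)) ^ n * (B + B))) (fun n => ?_)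
      (fun n => Eventually.of_forall fun ω => ?_) (Eventually.of_forall fun ω => ?_)
      (integrable_const _) (Eventually.of_forall fun ω => ?_)
    · exact (((hZ'.mul (hI.pow_const n)).mul (hfY.sub hPY)).const_mul _).aestronglyMeasurable
    · rw [Real.norm_eq_abs, abs_mul, abs_mul, abs_mul, abs_of_nonneg (by positivity :
        (0 : ℝ) ≤ (n.factorial : ℝ)⁻¹), abs_pow]
      have h1 := abs_additive_le hK Y s.coe_nonneg ω
      have h2 := (abs_sub (f (Y (s + t) ω)) (M.semigroup t f (Y s ω))).trans
        (add_le_add (hB _) (M.abs_semigroup_le t hB _))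
      have h0 := (abs_nonneg _).trans (hD ω)
      refine mul_le_mul_of_nonneg_left ?_ (by positivity)
      exact mul_le_mul (mul_le_mul (hD ω) (pow_le_pow_left₀ (abs_nonneg _) h1 n) (by positivity)
        h0) h2 (abs_nonneg _) (mul_nonneg h0 (pow_nonneg ((abs_nonneg _).trans h1) n))
    · have := (Real.summable_pow_div_factorial (K * (s - 0))).mul_left (D * (B + B))
      refine this.congr fun n => ?_
      ring
    · have h1 : HasSum (fun n : ℕ => additive W Y 0 s ω ^ n / (n.factorial : ℝ))
          (Real.exp (additive W Y 0 s ω)) := by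
        rw [Real.exp_eq_exp_ℝ]
        exact NormedSpace.expSeries_div_hasSum_exp (additive W Y 0 s ω)
      have h2 := h1.mul_left (Z ω * (f (Y (s + t) ω) - M.semigroup t f (Y s ω)))
      have e : Z ω * Real.exp (additive W Y 0 s ω) * f (Y (s + t) ω) -
          Z ω * Real.exp (additive W Y 0 s ω) * M.semigroup t f (Y s ω) =
          Z ω * (f (Y (s + t) ω) - M.semigroup t f (Y s ω)) * Real.exp (additive W Y 0 s ω) := by
        ring
      rw [e]
      refine (congrArg (HasSum · _) (funext fun n => ?_)).mpr h2
      ring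
  simp only [integral_const_mul,
    h.integral_mul_additive_pow_mul_eq_zero hW hK hf hB s t _ Z hZ D hD, mul_zero] at hs
  exact hs.unique hasSum_zero

/-- Duhamel's formula for the Feynman-Kac functional. -/
theorem integral_exp_additive_mul_eq [IsProbabilityMeasure Q] (h : M.IsMarkovUnder Y Q)
    {W : E → ℝ} (hW : Measurable W) {K : ℝ} (hK : ∀ x, |W x| ≤ K)
    {f : E → ℝ} (hf : Measurable f) {B : ℝ} (hB : ∀ x, |f x| ≤ B) {t : ℝ} (ht : 0 ≤ t) :
    ∫ ω, Real.exp (additive W Y 0 t ω) * f (Y t.toNNReal ω) ∂Q =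
      ∫ ω, f (Y t.toNNReal ω) ∂Q + ∫ s in (0 : ℝ)..t, ∫ ω, Real.exp (additive W Y 0 s ω) *
        (W (Y s.toNNReal ω) * M.semigroup (t - s).toNNReal f (Y s.toNNReal ω)) ∂Q := by
  have hfY : Measurable fun ω => f (Y t.toNNReal ω) := hf.comp (h.measurable_at _)
  have hK0 : ∀ ω, 0 ≤ K := fun ω => (abs_nonneg _).trans (hK (Y 0 ω))
  have hem : Measurable fun p : ℝ × Ω => Real.exp (additive W Y 0 p.1 p.2) :=
    Real.measurable_exp.comp ((measurable_additive_prod hW h.measurable).comp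
      (f := fun p : ℝ × Ω => (((0 : ℝ), p.1), p.2)) (by fun_prop))
  have hFm : Measurable fun p : ℝ × Ω => Real.exp (additive W Y 0 p.1 p.2) *
      W (Y p.1.toNNReal p.2) * f (Y t.toNNReal p.2) :=
    (hem.mul (hW.comp h.measurable_real)).mul (hfY.comp measurable_snd)
  have hFb : ∀ s ∈ Set.Ioc 0 t, ∀ ω, |Real.exp (additive W Y 0 s ω) *
      W (Y s.toNNReal ω) * f (Y t.toNNReal ω)| ≤ Real.exp (K * t) * K * B := by
    intro s hs ω
    rw [abs_mul, abs_mul]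
    have h1 := (exp_additive_le hK Y hs.1.le ω).trans
      (Real.exp_le_exp.2 (mul_le_mul_of_nonneg_left (by linarith [hs.2] : s - 0 ≤ t) (hK0 ω)))
    exact mul_le_mul (mul_le_mul h1 (hK _) (abs_nonneg _) (Real.exp_pos _).le) (hB _)
      (abs_nonneg _) (mul_nonneg (Real.exp_pos _).le (hK0 ω))
  have hpath : ∀ ω, Real.exp (additive W Y 0 t ω) * f (Y t.toNNReal ω) = f (Y t.toNNReal ω) +
      ∫ s in (0 : ℝ)..t, Real.exp (additive W Y 0 s ω) *
        W (Y s.toNNReal ω) * f (Y t.toNNReal ω) := fun ω => by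
    rw [exp_additive_eq hW hK h.measurable, intervalIntegral.integral_mul_const]
    ring
  have hIm : Measurable fun ω => ∫ s in (0 : ℝ)..t, Real.exp (additive W Y 0 s ω) *
      W (Y s.toNNReal ω) * f (Y t.toNNReal ω) :=
    (measurable_intervalIntegral_prod hFm).comp (measurable_prodMk_left (x := ((0 : ℝ), t)))
  have hIb : ∀ ω, |∫ s in (0 : ℝ)..t, Real.exp (additive W Y 0 s ω) *
      W (Y s.toNNReal ω) * f (Y t.toNNReal ω)| ≤ Real.exp (K * t) * K * B * |t - 0| := fun ω => by
    rw [← Real.norm_eq_abs]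
    refine intervalIntegral.norm_integral_le_of_norm_le_const fun s hs => ?_
    rw [Set.uIoc_of_le ht] at hs
    exact hFb s hs ω
  simp only [hpath]
  rw [integral_add (integrable_of_abs_le hfY fun _ => hB _) (integrable_of_abs_le hIm hIb),
    integral_intervalIntegral_comm hFm ht hFb]
  congr 1
  refine intervalIntegral.integral_congr fun s hs => ?_
  rw [Set.uIcc_of_le ht] at hs
  have hst : t.toNNReal = s.toNNReal + (t - s).toNNReal := by
    rw [← Real.toNNReal_add hs.1 (sub_nonneg.2 hs.2), add_sub_cancel]
  have hs' : (s.toNNReal : ℝ) = s := Real.coe_toNNReal _ hs.1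
  -- The Markov property between `s` and `t` replaces `f(Y_t)` by `P_{t-s} f(Y_s)`, with `W(Y_s)` in
  -- the role of `Z`.
  have := h.integral_mul_exp_additive_mul_eq hW hK hf hB s.toNNReal (t - s).toNNReal
    (Z := fun ω => W (Y s.toNNReal ω)) (hW.comp (measurable_past Y le_rfl)) (fun ω => hK _)
  rw [hs', ← hst] at this
  calc _ = ∫ ω, W (Y s.toNNReal ω) * Real.exp (additive W Y 0 s ω) * f (Y t.toNNReal ω) ∂Q :=
        integral_congr_ae (Eventually.of_forall fun ω => by ring)
    _ = _ := this
    _ = _ := integral_congr_ae (Eventually.of_forall fun ω => by simp only; ring)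

end IsMarkovUnder

/-- The Feynman-Kac functional depends on a Markov process only through its initial law. -/
theorem IsMarkovUnder.integral_exp_additive_congr {M : MarkovProcess E Ω}
    {Y₁ Y₂ : ℝ≥0 → Ω → E} {Q₁ Q₂ : Measure Ω} [IsProbabilityMeasure Q₁] [IsProbabilityMeasure Q₂]
    (h₁ : M.IsMarkovUnder Y₁ Q₁) (h₂ : M.IsMarkovUnder Y₂ Q₂)
    (hinit : Q₁.map (Y₁ 0) = Q₂.map (Y₂ 0)) {W : E → ℝ} (hW : Measurable W) {K : ℝ}
    (hK : ∀ x, |W x| ≤ K) {f : E → ℝ} (hf : Measurable f) {B : ℝ} (hB : ∀ x, |f x| ≤ B)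
    {t : ℝ} (ht : 0 ≤ t) :
    ∫ ω, Real.exp (additive W Y₁ 0 t ω) * f (Y₁ t.toNNReal ω) ∂Q₁ =
      ∫ ω, Real.exp (additive W Y₂ 0 t ω) * f (Y₂ t.toNNReal ω) ∂Q₂ := by
  obtain ⟨ω₀⟩ : Nonempty Ω := nonempty_of_isProbabilityMeasure Q₁
  have hK0 : 0 ≤ K := (abs_nonneg _).trans (hK (Y₁ 0 ω₀))
  have hone : ∀ (f : E → ℝ) (_ : Measurable f) (B : ℝ) (_ : ∀ x, |f x| ≤ B) (t : ℝ≥0),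
      ∫ ω, f (Y₁ t ω) ∂Q₁ = ∫ ω, f (Y₂ t ω) ∂Q₂ := by
    intro f hf B hB t
    have e1 := h₁.integral_eq 0 t hf hB
    have e2 := h₂.integral_eq 0 t hf hB
    rw [zero_add] at e1 e2
    rw [e1, e2, ← integral_map (h₁.measurable_at 0).aemeasurable
      (M.measurable_semigroup t hf).aestronglyMeasurable, hinit,
      integral_map (h₂.measurable_at 0).aemeasurable
      (M.measurable_semigroup t hf).aestronglyMeasurable]
  have hbd : ∀ {Y : ℝ≥0 → Ω → E} {Q : Measure Ω} [IsProbabilityMeasure Q] (f : E → ℝ) (B : ℝ)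
      (_ : ∀ x, |f x| ≤ B) (s : ℝ), 0 ≤ s → s ≤ t →
      |∫ ω, Real.exp (additive W Y 0 s ω) * f (Y s.toNNReal ω) ∂Q| ≤ Real.exp (K * t) * B := by
    intro Y Q _ f B hB s hs hst
    refine abs_integral_le_of_abs_le fun ω => ?_
    rw [abs_mul]
    have h1 := (exp_additive_le hK Y hs ω).trans
      (Real.exp_le_exp.2 (mul_le_mul_of_nonneg_left (by linarith : s - 0 ≤ t) hK0))
    exact mul_le_mul h1 (hB _) (abs_nonneg _) (Real.exp_pos _).le
  have hmeas : ∀ {Y : ℝ≥0 → Ω → E} {Q : Measure Ω} [IsProbabilityMeasure Q]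
      (_ : M.IsMarkovUnder Y Q) (f : E → ℝ) (_ : Measurable f) (s : ℝ),
      Measurable fun r : ℝ => ∫ ω, Real.exp (additive W Y 0 r ω) *
        (W (Y r.toNNReal ω) * M.semigroup (s - r).toNNReal f (Y r.toNNReal ω)) ∂Q := by
    intro Y Q _ h f hf s
    refine measurable_integral_prod (F := fun p : ℝ × Ω => Real.exp (additive W Y 0 p.1 p.2) *
        (W (Y p.1.toNNReal p.2) * M.semigroup (s - p.1).toNNReal f (Y p.1.toNNReal p.2))) ?_
    refine Measurable.mul ?_ ((hW.comp h.measurable_real).mul ?_)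
    · exact Real.measurable_exp.comp ((measurable_additive_prod hW h.measurable).comp
        (f := fun p : ℝ × Ω => (((0 : ℝ), p.1), p.2)) (by fun_prop))
    · exact (M.measurable_semigroup_prod hf).comp
        ((measurable_real_toNNReal.comp (measurable_const.sub measurable_fst)).prodMk
          h.measurable_real)
  -- Picard iteration of Duhamel's formula. The terms without `W` agree by `hone`; in the others `f`
  -- is replaced by `W P_{s-r} f`, with bound `K B` instead of `B`. Hence the induction is over all
  -- bounded `f`, and integrating `r^n` produces the next term of the exponential series.
  have key : ∀ (n : ℕ) (f : E → ℝ) (_ : Measurable f) (B : ℝ) (_ : ∀ x, |f x| ≤ B) (s : ℝ),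
      0 ≤ s → s ≤ t →
      |∫ ω, Real.exp (additive W Y₁ 0 s ω) * f (Y₁ s.toNNReal ω) ∂Q₁ -
        ∫ ω, Real.exp (additive W Y₂ 0 s ω) * f (Y₂ s.toNNReal ω) ∂Q₂| ≤
      2 * Real.exp (K * t) * B * ((K * s) ^ n / n.factorial) := by
    intro n
    induction n with
    | zero =>
      intro f hf B hB s hs hst
      have := (abs_sub _ _).trans (add_le_add (hbd (Y := Y₁) (Q := Q₁) f B hB s hs hst)
        (hbd (Y := Y₂) (Q := Q₂) f B hB s hs hst))
      simp only [pow_zero, Nat.factorial_zero, Nat.cast_one, div_one, mul_one]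
      linarith
    | succ n ih =>
      intro f hf B hB s hs hst
      have hWb : ∀ r x, |W x * M.semigroup (s - r).toNNReal f x| ≤ K * B := fun r x => by
        rw [abs_mul]
        exact mul_le_mul (hK x) (M.abs_semigroup_le _ hB x) (abs_nonneg _) hK0
      have hii : ∀ {Y : ℝ≥0 → Ω → E} {Q : Measure Ω} [IsProbabilityMeasure Q]
          (_ : M.IsMarkovUnder Y Q), IntervalIntegrable (fun r : ℝ =>
            ∫ ω, Real.exp (additive W Y 0 r ω) *
            (W (Y r.toNNReal ω) * M.semigroup (s - r).toNNReal f (Y r.toNNReal ω)) ∂Q)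
            volume 0 s := by
        intro Y Q _ h
        rw [intervalIntegrable_iff_integrableOn_Ioc_of_le hs]
        refine Measure.integrableOn_of_bounded (M := Real.exp (K * t) * (K * B)) (by simp)
          (hmeas h f hf s).aestronglyMeasurable ?_
        filter_upwards [ae_restrict_mem measurableSet_Ioc] with r hr
        exact hbd (fun x => W x * M.semigroup (s - r).toNNReal f x) _ (hWb r) r hr.1.le
          (hr.2.trans hst)
      rw [h₁.integral_exp_additive_mul_eq hW hK hf hB hs,
        h₂.integral_exp_additive_mul_eq hW hK hf hB hs, hone f hf B hB, add_sub_add_left_eq_sub,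
        ← intervalIntegral.integral_sub (hii h₁) (hii h₂)]
      have hle := fun r (hr : r ∈ Set.Ioc 0 s) =>
        ih (fun x => W x * M.semigroup (s - r).toNNReal f x)
          (hW.mul (M.measurable_semigroup _ hf)) (K * B) (hWb r) r hr.1.le (hr.2.trans hst)
      refine (intervalIntegral.norm_integral_le_of_norm_le hs
        (Eventually.of_forall fun r hr => (Real.norm_eq_abs _).trans_le (hle r hr)) ?_).trans_eq ?_
      · exact (Continuous.intervalIntegrable (by fun_prop) _ _)
      · rw [intervalIntegral.integral_const_mul, intervalIntegral.integral_div]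
        simp only [mul_pow]
        rw [intervalIntegral.integral_const_mul, integral_pow, Nat.factorial_succ]
        have : (n : ℝ) + 1 ≠ 0 := by positivity
        have h' : (n.factorial : ℝ) ≠ 0 := by positivity
        push_cast
        field_simp
        ring
  have hlim : Tendsto (fun n : ℕ => 2 * Real.exp (K * t) * B * ((K * t) ^ n / n.factorial))
      atTop (𝓝 0) := by
    simpa using (FloorSemiring.tendsto_pow_div_factorial_atTop (K * t)).const_mul
      (2 * Real.exp (K * t) * B)
  have := ge_of_tendsto' hlim fun n => key n f hf B hB t ht le_rfl
  exact sub_eq_zero.1 (abs_eq_zero.1 (le_antisymm this (abs_nonneg _)))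

end MarkovProcess

/-! ### General initial laws, shifted processes and stationarity. -/

namespace MarkovProcess

variable {E Ω : Type*} [MeasurableSpace E] [MeasurableSpace Ω]

theorem isMarkovUnder_law (M : MarkovProcess E Ω) (x : E) : M.IsMarkovUnder M.X (M.law x) where
  measurable := M.measurable_X
  markov s t A B hA hB := by
    have := M.markov x s t A B hA hB
    simp only [transition, Kernel.map_apply' _ (M.measurable_X_at t) _ hB]
    exact this

/-- `Ω` carries no shift operators, so the Markov property of the future after `h` is expressed
through the process `X_{h + ·}`. Its past at `s` is contained in the past of `X` at `h + s`. -/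
theorem isMarkovUnder_shift (M : MarkovProcess E Ω) (h : ℝ≥0) (x : E) :
    M.IsMarkovUnder (fun t => M.X (h + t)) (M.law x) where
  measurable := M.measurable_X.comp
    ((measurable_const.add measurable_fst).prodMk measurable_snd)
  markov s t A B hA hB := by
    have hle : past (fun t => M.X (h + t)) s ≤ past M.X (h + s) :=
      iSup₂_le fun u hu => le_iSup₂_of_le (h + u) (by gcongr) le_rfl
    have := (M.isMarkovUnder_law x).markov (h + s) t A B (hle _ hA) hB
    simpa only [add_assoc] using this

instance isProbabilityMeasure_initLaw (M : MarkovProcess E Ω) (ν : Measure E)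
    [IsProbabilityMeasure ν] : IsProbabilityMeasure (M.initLaw ν) := by
  unfold initLaw; infer_instance

theorem isMarkovUnder_initLaw (M : MarkovProcess E Ω) (ν : Measure E) :
    M.IsMarkovUnder M.X (M.initLaw ν) where
  measurable := M.measurable_X
  markov s t A B hA hB := by
    have hA' : MeasurableSet A := past_le M.measurable_X s A hA
    have hm : Measurable fun ω => M.transition t (M.X s ω) B :=
      ((M.transition t).measurable_coe hB).comp (M.measurable_X_at s)
    have hAB : MeasurableSet (A ∩ {ω | M.X (s + t) ω ∈ B}) :=
      hA'.inter (M.measurable_X_at _ hB)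
    rw [initLaw, Measure.bind_apply hAB M.law.measurable.aemeasurable,
      ← lintegral_indicator hA', Measure.lintegral_bind M.law.measurable.aemeasurable
        (hm.indicator hA').aemeasurable]
    refine lintegral_congr fun x => ?_
    rw [lintegral_indicator hA']
    exact (M.isMarkovUnder_law x).markov s t A B hA hB

theorem integral_initLaw (M : MarkovProcess E Ω) (ν : Measure E) [IsProbabilityMeasure ν]
    {Z : Ω → ℝ} (hZ : Integrable Z (M.initLaw ν)) :
    ∫ ω, Z ω ∂(M.initLaw ν) = ∫ x, ∫ ω, Z ω ∂(M.law x) ∂ν :=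
  integral_bind_eq hZ

theorem map_X_zero_initLaw (M : MarkovProcess E Ω) (ν : Measure E) :
    (M.initLaw ν).map (M.X 0) = ν := by
  ext B hB
  rw [Measure.map_apply (M.measurable_X_at 0) hB, initLaw,
    Measure.bind_apply (M.measurable_X_at 0 hB) M.law.measurable.aemeasurable]
  have : ∀ x, M.law x (M.X 0 ⁻¹' B) = B.indicator 1 x := fun x => by
    rw [← Measure.map_apply (M.measurable_X_at 0) hB, M.map_X_zero, Measure.dirac_apply' _ hB]
  simp only [this, lintegral_indicator_one hB]

theorem map_X_initLaw (M : MarkovProcess E Ω) {μ : Measure E} [IsProbabilityMeasure μ]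
    (hμ : M.IsInvariant μ) (t : ℝ≥0) : (M.initLaw μ).map (M.X t) = μ := by
  have h := (M.isMarkovUnder_initLaw μ).map_restrict 0 t (A := Set.univ) MeasurableSet.univ
  rw [Measure.restrict_univ, zero_add, map_X_zero_initLaw] at h
  rw [h]
  exact hμ t

/-! ## The Feynman-Kac functional -/

/-- The Feynman-Kac functional `E_x[exp(∫_0^t W(X_r) dr) f(X_t)]`. -/
noncomputable def feynmanKac (M : MarkovProcess E Ω) (W : E → ℝ) (t : ℝ) (f : E → ℝ) (x : E) : ℝ :=
  ∫ ω, Real.exp (additive W M.X 0 t ω) * f (M.X t.toNNReal ω) ∂(M.law x)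

theorem measurable_exp_additive_mul (M : MarkovProcess E Ω) {W : E → ℝ} (hW : Measurable W)
    {f : E → ℝ} (hf : Measurable f) :
    Measurable fun p : ℝ × Ω => Real.exp (additive W M.X 0 p.1 p.2) * f (M.X p.1.toNNReal p.2) :=
  (Real.measurable_exp.comp ((measurable_additive_prod hW M.measurable_X).comp
      (f := fun p : ℝ × Ω => (((0 : ℝ), p.1), p.2)) (by fun_prop))).mul
    (hf.comp (M.measurable_X.comp
      ((measurable_real_toNNReal.comp measurable_fst).prodMk measurable_snd)))

theorem measurable_feynmanKac_prod (M : MarkovProcess E Ω) {W : E → ℝ} (hW : Measurable W)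
    {f : E → ℝ} (hf : Measurable f) :
    Measurable fun p : ℝ × E => M.feynmanKac W p.1 f p.2 :=
  measurable_integral_kernel_prod (M.measurable_exp_additive_mul hW hf)

theorem measurable_feynmanKac (M : MarkovProcess E Ω) {W : E → ℝ} (hW : Measurable W)
    {f : E → ℝ} (hf : Measurable f) (t : ℝ) : Measurable (M.feynmanKac W t f) :=
  (M.measurable_feynmanKac_prod hW hf).comp measurable_prodMk_left

theorem abs_exp_additive_mul_le (M : MarkovProcess E Ω) {W : E → ℝ} {K : ℝ} (hK : ∀ x, |W x| ≤ K)
    {f : E → ℝ} {B : ℝ} (hB : ∀ x, |f x| ≤ B) {s t : ℝ} (hs : 0 ≤ s) (hst : s ≤ t) (ω : Ω) :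
    |Real.exp (additive W M.X 0 s ω) * f (M.X s.toNNReal ω)| ≤ Real.exp (K * t) * B := by
  have hK0 : 0 ≤ K := (abs_nonneg _).trans (hK (M.X 0 ω))
  rw [abs_mul]
  have h1 := (exp_additive_le hK M.X hs ω).trans
    (Real.exp_le_exp.2 (mul_le_mul_of_nonneg_left (by linarith : s - 0 ≤ t) hK0))
  exact mul_le_mul h1 (hB _) (abs_nonneg _) (Real.exp_pos _).le

theorem abs_feynmanKac_le (M : MarkovProcess E Ω) {W : E → ℝ} {K : ℝ} (hK : ∀ x, |W x| ≤ K)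
    {f : E → ℝ} {B : ℝ} (hB : ∀ x, |f x| ≤ B) {s t : ℝ} (hs : 0 ≤ s) (hst : s ≤ t) (x : E) :
    |M.feynmanKac W s f x| ≤ Real.exp (K * t) * B :=
  abs_integral_le_of_abs_le fun ω => M.abs_exp_additive_mul_le hK hB hs hst ω

/-- The derivative in the terminal time: the pathwise identity `exp_additive_eq` averaged with
Fubini. -/
theorem feynmanKac_one_eq (M : MarkovProcess E Ω) {W : E → ℝ} (hW : Measurable W)
    {K : ℝ} (hK : ∀ x, |W x| ≤ K) {t : ℝ} (ht : 0 ≤ t) (x : E) :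
    M.feynmanKac W t (fun _ => 1) x = 1 + ∫ s in (0 : ℝ)..t, M.feynmanKac W s W x := by
  have hb : ∀ s ∈ Set.Ioc 0 t, ∀ ω, |Real.exp (additive W M.X 0 s ω) * W (M.X s.toNNReal ω)| ≤
      Real.exp (K * t) * K := fun s hs ω => M.abs_exp_additive_mul_le hK hK hs.1.le hs.2 ω
  have hm := M.measurable_exp_additive_mul hW hW
  simp only [feynmanKac, mul_one, exp_additive_eq hW hK M.measurable_X t]
  rw [integral_add (integrable_const _), integral_intervalIntegral_comm hm ht hb]
  · simp
  · refine integrable_of_abs_le (B := Real.exp (K * t) * K * |t - 0|)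
      ((measurable_intervalIntegral_prod hm).comp (measurable_prodMk_left (x := ((0 : ℝ), t)))) ?_
    intro ω
    rw [← Real.norm_eq_abs]
    refine intervalIntegral.norm_integral_le_of_norm_le_const fun s hs => ?_
    rw [Set.uIoc_of_le ht] at hs
    exact hb s hs ω

/-- The Markov property for the Feynman-Kac functional of the future. -/
theorem semigroup_feynmanKac_one (M : MarkovProcess E Ω) {W : E → ℝ} (hW : Measurable W)
    {K : ℝ} (hK : ∀ x, |W x| ≤ K) {t : ℝ} (ht : 0 ≤ t) (h : ℝ≥0) (x : E) :
    M.semigroup h (M.feynmanKac W t fun _ => 1) x =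
      ∫ ω, Real.exp (additive W M.X h (h + t) ω) ∂(M.law x) := by
  -- The shifted process under `P_x` and the original one under the initial law `P_h(x, ·)` start
  -- from the same distribution, so their Feynman-Kac functionals coincide.
  have hinit : (M.law x).map (M.X (h + 0)) =
      (M.initLaw (M.transition h x)).map (M.X 0) := by
    rw [map_X_zero_initLaw, transition, Kernel.map_apply _ (M.measurable_X_at h), add_zero]
  have key := (M.isMarkovUnder_shift h x).integral_exp_additive_congr
    (M.isMarkovUnder_initLaw (M.transition h x)) hinit hW hK (f := fun _ => 1)
    measurable_const (B := 1) (by simp) ht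
  simp only [mul_one] at key
  have hshift : ∀ ω, additive W (fun t => M.X (h + t)) 0 t ω = additive W M.X h (h + t) ω := by
    intro ω
    have e := intervalIntegral.integral_comp_add_left (a := 0) (b := t)
      (fun r : ℝ => W (M.X r.toNNReal ω)) (h : ℝ)
    rw [add_zero] at e
    rw [additive, additive, ← e]
    refine intervalIntegral.integral_congr fun r hr => ?_
    rw [Set.uIcc_of_le ht] at hr
    simp only [Real.toNNReal_add h.coe_nonneg hr.1, Real.toNNReal_coe]
  simp only [hshift] at key
  rw [key, integral_initLaw]
  · simp only [semigroup, feynmanKac, mul_one]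
  · exact integrable_of_abs_le (Real.measurable_exp.comp (measurable_additive hW M.measurable_X 0 t))
      fun ω => exp_additive_le hK M.X ht ω

/-! ## Stochastic continuity of the stationary process -/

/-- Under the stationary law the pair `(X_s, X_{s+h})` has distribution `μ ⊗ P_h` whatever `s` is.
-/
theorem integral_abs_increment_eq (M : MarkovProcess E Ω) {μ : Measure E} [IsProbabilityMeasure μ]
    (hμ : M.IsInvariant μ) {W : E → ℝ} (hW : Measurable W) (s h : ℝ≥0) :
    ∫ ω, |W (M.X (s + h) ω) - W (M.X s ω)| ∂(M.initLaw μ) =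
      ∫ ω, |W (M.X h ω) - W (M.X 0 ω)| ∂(M.initLaw μ) := by
  have hlaw : ∀ s : ℝ≥0, (M.initLaw μ).map (fun ω => (M.X s ω, M.X (s + h) ω)) =
      μ ⊗ₘ (M.transition h) := by
    intro s
    have hm : Measurable fun ω => (M.X s ω, M.X (s + h) ω) :=
      (M.measurable_X_at s).prodMk (M.measurable_X_at _)
    have : IsProbabilityMeasure ((M.initLaw μ).map (fun ω => (M.X s ω, M.X (s + h) ω))) :=
      Measure.isProbabilityMeasure_map hm.aemeasurable
    refine Measure.ext_prod fun {A B} hA hB => ?_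
    rw [Measure.map_apply hm (hA.prod hB), Measure.compProd_apply_prod hA hB]
    have h1 := (M.isMarkovUnder_initLaw μ).markov s h (M.X s ⁻¹' A) B
      (measurable_past M.X le_rfl hA) hB
    have h2 : (fun ω => (M.X s ω, M.X (s + h) ω)) ⁻¹' A ×ˢ B =
        M.X s ⁻¹' A ∩ {ω | M.X (s + h) ω ∈ B} := rfl
    rw [h2, h1, ← map_X_initLaw M hμ s]
    rw [setLIntegral_map hA ((M.transition h).measurable_coe hB) (M.measurable_X_at s),
      map_X_initLaw M hμ s]
  have hint : ∀ s : ℝ≥0, ∫ ω, |W (M.X (s + h) ω) - W (M.X s ω)| ∂(M.initLaw μ) =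
      ∫ p, |W p.2 - W p.1| ∂(μ ⊗ₘ (M.transition h)) := by
    intro s
    rw [← hlaw s, integral_map]
    · exact ((M.measurable_X_at s).prodMk (M.measurable_X_at _)).aemeasurable
    · exact (Measurable.aestronglyMeasurable (by fun_prop))
  have h0 := hint 0
  rw [zero_add] at h0
  rw [hint s, h0]

/-- A jointly measurable stationary Markov process is stochastically continuous at time `0`. -/
theorem tendsto_integral_abs_increment (M : MarkovProcess E Ω) {μ : Measure E}
    [IsProbabilityMeasure μ] (hμ : M.IsInvariant μ) {W : E → ℝ} (hW : Measurable W)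
    {K : ℝ} (hK : ∀ x, |W x| ≤ K) :
    Tendsto (fun h : ℝ≥0 => ∫ ω, |W (M.X h ω) - W (M.X 0 ω)| ∂(M.initLaw μ)) (𝓝 0) (𝓝 0) := by
  have hb : ∀ x y, |W x - W y| ≤ K + K := fun x y =>
    (abs_sub _ _).trans (add_le_add (hK _) (hK _))
  -- Stationarity allows averaging over the starting time `s ∈ [0, 1]`. Path by path the inner
  -- integral then tends to `0` by continuity of translations in `L¹`, with no regularity of the
  -- path.
  have hrepr : ∀ h : ℝ≥0, ∫ ω, |W (M.X h ω) - W (M.X 0 ω)| ∂(M.initLaw μ) =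
      ∫ ω, (∫ s in (0 : ℝ)..1, |W (M.X (s + h).toNNReal ω) - W (M.X s.toNNReal ω)|)
        ∂(M.initLaw μ) := by
    intro h
    have hm : Measurable fun p : ℝ × Ω =>
        |W (M.X (p.1 + h).toNNReal p.2) - W (M.X p.1.toNNReal p.2)| := by
      have h1 : Measurable fun p : ℝ × Ω => M.X (p.1 + h).toNNReal p.2 := M.measurable_X.comp
        ((measurable_real_toNNReal.comp (measurable_fst.add_const _)).prodMk measurable_snd)
      have h2 : Measurable fun p : ℝ × Ω => M.X p.1.toNNReal p.2 := M.measurable_X.comp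
        ((measurable_real_toNNReal.comp measurable_fst).prodMk measurable_snd)
      exact ((hW.comp h1).sub (hW.comp h2)).abs
    rw [integral_intervalIntegral_comm (B := K + K) hm zero_le_one
      (fun s _ ω => by rw [abs_abs]; exact hb _ _)]
    have : ∀ s ∈ Set.uIcc (0 : ℝ) 1,
        ∫ ω, |W (M.X (s + h).toNNReal ω) - W (M.X s.toNNReal ω)| ∂(M.initLaw μ) =
        ∫ ω, |W (M.X h ω) - W (M.X 0 ω)| ∂(M.initLaw μ) := fun s hs => by
      rw [Set.uIcc_of_le zero_le_one] at hs
      rw [Real.toNNReal_add hs.1 h.coe_nonneg, Real.toNNReal_coe,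
        integral_abs_increment_eq M hμ hW]
    rw [intervalIntegral.integral_congr this]
    simp
  simp only [hrepr]
  rw [show 𝓝 (0 : ℝ) = 𝓝 (∫ _ω : Ω, (0 : ℝ) ∂(M.initLaw μ)) by simp]
  refine tendsto_integral_filter_of_dominated_convergence (fun _ => K + K)
    (Eventually.of_forall fun h => ?_) (Eventually.of_forall fun h => Eventually.of_forall fun ω => ?_)
    (integrable_const _) (Eventually.of_forall fun ω => ?_)
  · have hm : Measurable fun p : ℝ × Ω =>
        |W (M.X (p.1 + h).toNNReal p.2) - W (M.X p.1.toNNReal p.2)| := by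
      have h1 : Measurable fun p : ℝ × Ω => M.X (p.1 + h).toNNReal p.2 := M.measurable_X.comp
        ((measurable_real_toNNReal.comp (measurable_fst.add_const _)).prodMk measurable_snd)
      have h2 : Measurable fun p : ℝ × Ω => M.X p.1.toNNReal p.2 := M.measurable_X.comp
        ((measurable_real_toNNReal.comp measurable_fst).prodMk measurable_snd)
      exact ((hW.comp h1).sub (hW.comp h2)).abs
    exact ((measurable_intervalIntegral_prod hm).comp
      (measurable_prodMk_left (x := ((0 : ℝ), (1 : ℝ))))).aestronglyMeasurable
  · refine (intervalIntegral.norm_integral_le_of_norm_le_const (C := K + K)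
      fun s _ => ?_).trans_eq (by simp)
    rw [Real.norm_eq_abs, abs_abs]
    exact hb _ _
  · have ht := tendsto_integral_abs_translate_sub (measurable_path hW M.measurable_X ω)
      (fun r => hK (M.X r.toNNReal ω))
    have hc : Tendsto (fun h : ℝ≥0 => (h : ℝ)) (𝓝 0) (𝓝 0) :=
      NNReal.continuous_coe.tendsto' 0 0 rfl
    exact ht.comp hc

end MarkovProcess

/-- Interpolation between `L¹` and `L^∞`: for uniformly bounded functions, convergence in mean gives
the `L²` convergence required by the generator. -/
theorem eLpNorm_two_le_sqrt {α : Type*} [MeasurableSpace α] {μ : Measure α} [IsFiniteMeasure μ]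
    {g : α → ℝ} (hg : Measurable g) {B : ℝ} (hB : ∀ x, |g x| ≤ B) :
    eLpNorm g 2 μ ≤ ENNReal.ofReal (Real.sqrt (B * ∫ x, |g x| ∂μ)) := by
  have hm : MemLp g 2 μ := MemLp.of_bound hg.aestronglyMeasurable B (Eventually.of_forall hB)
  rw [hm.eLpNorm_eq_integral_rpow_norm two_ne_zero ENNReal.ofNat_ne_top]
  refine ENNReal.ofReal_le_ofReal ?_
  simp only [ENNReal.toReal_ofNat, Real.rpow_ofNat, Real.norm_eq_abs]
  rw [Real.sqrt_eq_rpow, one_div]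
  refine Real.rpow_le_rpow (integral_nonneg fun _ => sq_nonneg _) ?_ (by norm_num)
  rw [← integral_const_mul]
  have hi : Integrable (fun x => |g x|) μ := (integrable_of_abs_le hg hB).abs
  refine integral_mono_of_nonneg (Eventually.of_forall fun x => sq_nonneg _) (hi.const_mul B)
    (Eventually.of_forall fun x => ?_)
  simp only [sq]
  exact mul_le_mul_of_nonneg_right (hB x) (abs_nonneg _)

/-! ### Differentiation in the starting time, and the resulting `L²` growth bound. -/

namespace MarkovProcess

variable {E Ω : Type*} [MeasurableSpace E] [MeasurableSpace Ω]

theorem ae_X_zero (M : MarkovProcess E Ω) {W : E → ℝ} (hW : Measurable W) (x : E) :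
    ∀ᵐ ω ∂(M.law x), W (M.X 0 ω) = W x := by
  have hs : MeasurableSet {y | W y = W x} := measurableSet_eq_fun hW measurable_const
  refine (ae_map_iff (M.measurable_X_at 0).aemeasurable hs).1 ?_
  rw [M.map_X_zero, ae_dirac_iff hs]

/-- The integrated oscillation `∫_s^{s+h} |W(X_r) - W(X_s)| dr`. -/
noncomputable def oscillation (M : MarkovProcess E Ω) (W : E → ℝ) (s h : ℝ≥0) (ω : Ω) : ℝ :=
  ∫ r in (s : ℝ)..(s + h), |W (M.X r.toNNReal ω) - W (M.X s ω)|

theorem integral_oscillation_le (M : MarkovProcess E Ω) {μ : Measure E}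
    [IsProbabilityMeasure μ] (hμ : M.IsInvariant μ) {W : E → ℝ} (hW : Measurable W)
    {K : ℝ} (hK : ∀ x, |W x| ≤ K) (s h : ℝ≥0) {ε : ℝ}
    (hε : ∀ r ≤ h, ∫ ω, |W (M.X r ω) - W (M.X 0 ω)| ∂(M.initLaw μ) ≤ ε) :
    ∫ ω, M.oscillation W s h ω ∂(M.initLaw μ) ≤ h * ε := by
  have hm : Measurable fun p : ℝ × Ω => |W (M.X p.1.toNNReal p.2) - W (M.X s p.2)| := by
    have h2 : Measurable fun p : ℝ × Ω => M.X p.1.toNNReal p.2 := M.measurable_X.comp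
        ((measurable_real_toNNReal.comp measurable_fst).prodMk measurable_snd)
    exact ((hW.comp h2).sub (hW.comp ((M.measurable_X_at s).comp measurable_snd))).abs
  have hle : (s : ℝ) ≤ s + h := le_add_of_nonneg_right h.coe_nonneg
  have hb : ∀ r ∈ Set.Ioc (s : ℝ) (s + h), ∀ ω,
      |(|W (M.X r.toNNReal ω) - W (M.X s ω)|)| ≤ K + K := fun r _ ω => by
    rw [abs_abs]
    exact (abs_sub _ _).trans (add_le_add (hK _) (hK _))
  simp only [oscillation]
  rw [integral_intervalIntegral_comm hm hle hb]
  refine (Real.le_norm_self _).trans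
    ((intervalIntegral.norm_integral_le_of_norm_le_const (C := ε) fun r hr => ?_).trans_eq ?_)
  · rw [Set.uIoc_of_le hle] at hr
    have hr' : r.toNNReal = s + (r - s).toNNReal := by
      have := Real.toNNReal_add s.coe_nonneg (sub_nonneg.2 hr.1.le)
      rwa [add_sub_cancel, Real.toNNReal_coe] at this
    rw [hr', integral_abs_increment_eq M hμ hW, Real.norm_eq_abs,
      abs_of_nonneg (integral_nonneg fun _ => abs_nonneg _)]
    refine hε _ (Real.toNNReal_le_iff_le_coe.2 ?_)
    linarith [hr.2]
  · rw [add_sub_cancel_left, abs_of_nonneg h.coe_nonneg, mul_comm]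

/-- The remainder in the first order expansion of `h ↦ exp(∫_h^{h+t} W(X_r) dr)` at `h = 0`. -/
noncomputable def expansionError (M : MarkovProcess E Ω) (W : E → ℝ) (t h : ℝ≥0) (ω : Ω) : ℝ :=
  (h : ℝ)⁻¹ * (Real.exp (additive W M.X h (h + t) ω) - Real.exp (additive W M.X 0 t ω)) -
    Real.exp (additive W M.X 0 t ω) * (W (M.X t ω) - W (M.X 0 ω))

theorem measurable_expansionError (M : MarkovProcess E Ω) {W : E → ℝ} (hW : Measurable W)
    (t h : ℝ≥0) : Measurable (M.expansionError W t h) := by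
  have h1 := measurable_additive hW M.measurable_X h (h + t)
  have h2 := measurable_additive hW M.measurable_X 0 t
  have h3 := hW.comp (M.measurable_X_at t)
  have h4 := hW.comp (M.measurable_X_at 0)
  exact (((Real.measurable_exp.comp h1).sub (Real.measurable_exp.comp h2)).const_mul _).sub
    ((Real.measurable_exp.comp h2).mul (h3.sub h4))

/-- Moving the window from `[0, t]` to `[h, h + t]` adds the piece `[t, t + h]` and drops `[0, h]`.
Both pieces have length `h`, so the difference is `O(h)`. -/
theorem additive_shift_sub (M : MarkovProcess E Ω) {W : E → ℝ} (hW : Measurable W)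
    {K : ℝ} (hK : ∀ x, |W x| ≤ K) (t h : ℝ≥0) (ω : Ω) :
    additive W M.X h (h + t) ω - additive W M.X 0 t ω =
      additive W M.X t (t + h) ω - additive W M.X 0 h ω := by
  have hi : ∀ a b : ℝ, IntervalIntegrable (fun r : ℝ => W (M.X r.toNNReal ω)) volume a b :=
    intervalIntegrable_of_bounded (measurable_path hW M.measurable_X ω) (fun r => hK _)
  have h1 := intervalIntegral.integral_add_adjacent_intervals (hi 0 h) (hi h (h + t))
  have h2 := intervalIntegral.integral_add_adjacent_intervals (hi 0 t) (hi t (t + h))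
  rw [add_comm (t : ℝ) h] at *
  simp only [additive]
  linarith

/-- The first bound is uniform in `h`; the second has small mean by stochastic continuity. Together
they feed `eLpNorm_two_le_sqrt`. With `a` the change of the exponent, `|a| ≤ 2Kh`. Then `|e^a - 1| ≤
2|a|` gives `4K`, to which `2K` is added, and `|e^a - 1 - a| ≤ a²` gives `4K²h` after division by
`h`. -/
theorem abs_expansionError_le (M : MarkovProcess E Ω) {W : E → ℝ} (hW : Measurable W)
    {K : ℝ} (hK : ∀ x, |W x| ≤ K) (t : ℝ≥0) {h : ℝ≥0} (hh : 0 < h) (hh' : 2 * K * h ≤ 1) (ω : Ω) :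
    |M.expansionError W t h ω| ≤ Real.exp (K * t) * (6 * K) ∧
    |M.expansionError W t h ω| ≤ Real.exp (K * t) * (4 * K ^ 2 * h +
      ((h : ℝ)⁻¹ * M.oscillation W t h ω + (h : ℝ)⁻¹ * M.oscillation W 0 h ω)) := by
  have hh0 : (0 : ℝ) < h := hh
  have hK0 : 0 ≤ K := (abs_nonneg _).trans (hK (M.X 0 ω))
  set a : ℝ := additive W M.X t (t + h) ω - additive W M.X 0 h ω with ha
  have hexp : M.expansionError W t h ω = Real.exp (additive W M.X 0 t ω) *
      ((h : ℝ)⁻¹ * (Real.exp a - 1) - (W (M.X t ω) - W (M.X 0 ω))) := by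
    have : additive W M.X h (h + t) ω = additive W M.X 0 t ω + a := by
      rw [ha, ← M.additive_shift_sub hW hK]; ring
    rw [expansionError, this, Real.exp_add]
    ring
  have haK : |a| ≤ 2 * K * h := by
    have h1 := abs_additive_le hK M.X (le_add_of_nonneg_right hh0.le : (t : ℝ) ≤ t + h) ω
    have h2 := abs_additive_le hK M.X hh0.le ω
    have := (abs_sub (additive W M.X t (t + h) ω) (additive W M.X 0 h ω)).trans (add_le_add h1 h2)
    rw [← ha] at this
    linarith
  have ha1 : |a| ≤ 1 := haK.trans hh'
  have hE : |Real.exp (additive W M.X 0 t ω)| ≤ Real.exp (K * t) := by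
    simpa using exp_additive_le hK M.X t.coe_nonneg ω
  have hd : |W (M.X t ω) - W (M.X 0 ω)| ≤ 2 * K :=
    (abs_sub _ _).trans (by linarith [hK (M.X t ω), hK (M.X 0 ω)])
  rw [hexp, abs_mul]
  constructor
  · refine mul_le_mul hE ?_ (abs_nonneg _) (Real.exp_pos _).le
    have h1 : |(h : ℝ)⁻¹ * (Real.exp a - 1)| ≤ 4 * K := by
      rw [abs_mul, abs_of_pos (inv_pos.2 hh0), inv_mul_le_iff₀ hh0]
      have := Real.abs_exp_sub_one_le ha1
      linarith
    exact (abs_sub _ _).trans (by linarith)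
  · refine mul_le_mul hE ?_ (abs_nonneg _) (Real.exp_pos _).le
    have hi : ∀ a b : ℝ, IntervalIntegrable (fun r : ℝ => W (M.X r.toNNReal ω)) volume a b :=
      intervalIntegrable_of_bounded (measurable_path hW M.measurable_X ω) (fun r => hK _)
    have hincr : ∀ s : ℝ≥0, |additive W M.X s (s + h) ω - h * W (M.X s ω)| ≤
        M.oscillation W s h ω := by
      intro s
      have e : additive W M.X s (s + h) ω - h * W (M.X s ω) =
          ∫ r in (s : ℝ)..(s + h), (W (M.X r.toNNReal ω) - W (M.X s ω)) := by
        rw [intervalIntegral.integral_sub (hi _ _) intervalIntegrable_const,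
          intervalIntegral.integral_const]
        simp [additive]
      rw [e]
      exact intervalIntegral.abs_integral_le_integral_abs (le_add_of_nonneg_right hh0.le)
    have e : (h : ℝ)⁻¹ * (Real.exp a - 1) - (W (M.X t ω) - W (M.X 0 ω)) =
        (h : ℝ)⁻¹ * (Real.exp a - 1 - a) +
        ((h : ℝ)⁻¹ * (additive W M.X t (t + h) ω - h * W (M.X t ω)) -
          (h : ℝ)⁻¹ * (additive W M.X (0 : ℝ≥0) ((0 : ℝ≥0) + h) ω - h * W (M.X 0 ω))) := by
      simp only [NNReal.coe_zero, zero_add]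
      rw [ha]
      field_simp
      ring
    rw [e]
    refine (abs_add_le _ _).trans (add_le_add ?_ ((abs_sub _ _).trans (add_le_add ?_ ?_)))
    · rw [abs_mul, abs_of_pos (inv_pos.2 hh0), inv_mul_le_iff₀ hh0]
      refine (Real.abs_exp_sub_one_sub_id_le ha1).trans ?_
      rw [← sq_abs]
      calc |a| ^ 2 ≤ (2 * K * h) ^ 2 := pow_le_pow_left₀ (abs_nonneg _) haK 2
        _ = h * (4 * K ^ 2 * h) := by ring
    · rw [abs_mul, abs_of_pos (inv_pos.2 hh0)]
      exact mul_le_mul_of_nonneg_left (hincr t) (inv_pos.2 hh0).le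
    · rw [abs_mul, abs_of_pos (inv_pos.2 hh0)]
      exact mul_le_mul_of_nonneg_left (hincr 0) (inv_pos.2 hh0).le

theorem tendsto_integral_abs_expansionError (M : MarkovProcess E Ω) {μ : Measure E}
    [IsProbabilityMeasure μ] (hμ : M.IsInvariant μ) {W : E → ℝ} (hW : Measurable W)
    {K : ℝ} (hK : ∀ x, |W x| ≤ K) (t : ℝ≥0) :
    Tendsto (fun h : ℝ≥0 => ∫ ω, |M.expansionError W t h ω| ∂(M.initLaw μ)) (𝓝[>] 0) (𝓝 0) := by
  have hb : ∀ x y, |W x - W y| ≤ K + K := fun x y =>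
    (abs_sub _ _).trans (add_le_add (hK _) (hK _))
  have hAm : ∀ s h : ℝ≥0, Integrable (M.oscillation W s h) (M.initLaw μ) := by
    intro s h
    have hm : Measurable fun p : ℝ × Ω => |W (M.X p.1.toNNReal p.2) - W (M.X s p.2)| := by
      have h2 : Measurable fun p : ℝ × Ω => M.X p.1.toNNReal p.2 := M.measurable_X.comp
          ((measurable_real_toNNReal.comp measurable_fst).prodMk measurable_snd)
      exact ((hW.comp h2).sub (hW.comp ((M.measurable_X_at s).comp measurable_snd))).abs
    refine integrable_of_abs_le (B := (K + K) * |(s + h : ℝ) - s|)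
      ((measurable_intervalIntegral_prod hm).comp
      (measurable_prodMk_left (x := ((s : ℝ), (s + h : ℝ))))) fun ω => ?_
    refine abs_intervalIntegral_le (fun r => ?_) _ _
    rw [abs_abs]
    exact hb _ _
  rw [tendsto_order]
  refine ⟨fun c hc => Eventually.of_forall fun h =>
    hc.trans_le (integral_nonneg fun _ => abs_nonneg _), fun c hc => ?_⟩
  -- The two oscillation terms contribute at most `2ε e^{Kt} = c/2`; the quadratic remainder is kept
  -- below the other `c/2`.
  set ε : ℝ := c / (4 * Real.exp (K * t)) with hε
  have hεpos : 0 < ε := by positivity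
  have hcoe : Tendsto (fun h : ℝ≥0 => (h : ℝ)) (𝓝 0) (𝓝 0) :=
    NNReal.continuous_coe.tendsto' 0 0 rfl
  have e1 : ∀ᶠ h : ℝ≥0 in 𝓝[>] 0, Real.exp (K * t) * (4 * K ^ 2 * h) < c / 2 := by
    have : Tendsto (fun h : ℝ≥0 => Real.exp (K * t) * (4 * K ^ 2 * h)) (𝓝 0) (𝓝 0) := by
      simpa using (hcoe.const_mul (4 * K ^ 2)).const_mul (Real.exp (K * t))
    exact (this.mono_left nhdsWithin_le_nhds).eventually_lt_const (by positivity)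
  have e2 : ∀ᶠ h : ℝ≥0 in 𝓝[>] 0, 2 * K * h < 1 := by
    have : Tendsto (fun h : ℝ≥0 => 2 * K * (h : ℝ)) (𝓝 0) (𝓝 0) := by
      simpa using hcoe.const_mul (2 * K)
    exact (this.mono_left nhdsWithin_le_nhds).eventually_lt_const one_pos
  have e3 : ∀ᶠ h : ℝ≥0 in 𝓝[>] 0, ∀ r ≤ h,
      ∫ ω, |W (M.X r ω) - W (M.X 0 ω)| ∂(M.initLaw μ) ≤ ε := by
    have := (M.tendsto_integral_abs_increment hμ hW hK).eventually_lt_const hεpos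
    obtain ⟨δ, hδ, hball⟩ := Metric.eventually_nhds_iff.1 this
    have hs : ∀ᶠ h : ℝ≥0 in 𝓝[>] 0, (h : ℝ) < δ :=
      (hcoe.mono_left nhdsWithin_le_nhds).eventually_lt_const hδ
    filter_upwards [hs] with h hh r hr
    refine (hball ?_).le
    rw [NNReal.dist_eq, NNReal.coe_zero, sub_zero, abs_of_nonneg r.coe_nonneg]
    exact lt_of_le_of_lt hr hh
  filter_upwards [e1, e2, e3, self_mem_nhdsWithin] with h h1 h2 h3 hpos
  have hh0 : (0 : ℝ) < h := hpos
  have hle := fun ω => (M.abs_expansionError_le hW hK t hpos h2.le ω).2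
  have i1 := (hAm t h).const_mul (h : ℝ)⁻¹
  have i2 := (hAm 0 h).const_mul (h : ℝ)⁻¹
  have b1 := M.integral_oscillation_le hμ hW hK t h h3
  have b2 := M.integral_oscillation_le hμ hW hK 0 h h3
  have i12 : Integrable (fun ω => (h : ℝ)⁻¹ * M.oscillation W t h ω +
      (h : ℝ)⁻¹ * M.oscillation W 0 h ω) (M.initLaw μ) := i1.add i2
  have i3 : Integrable (fun ω => 4 * K ^ 2 * (h : ℝ) + ((h : ℝ)⁻¹ * M.oscillation W t h ω +
      (h : ℝ)⁻¹ * M.oscillation W 0 h ω)) (M.initLaw μ) := (integrable_const _).add i12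
  have s1 := integral_mono_of_nonneg (Eventually.of_forall fun _ => abs_nonneg _)
    (i3.const_mul (Real.exp (K * t))) (Eventually.of_forall hle)
  rw [integral_const_mul, integral_add (integrable_const _) i12, integral_add i1 i2,
    integral_const, probReal_univ, one_smul, integral_const_mul, integral_const_mul] at s1
  have c1 := (inv_mul_le_iff₀ hh0).2 b1
  have c2 := (inv_mul_le_iff₀ hh0).2 b2
  have s2 := mul_le_mul_of_nonneg_left (add_le_add c1 c2) (Real.exp_pos (K * t)).le
  have s3 : Real.exp (K * t) * (ε + ε) = c / 2 := by
    rw [hε]; field_simp; norm_num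
  linarith

/-- `exp(∫_0^t W(X_r) dr)` has an expectation, as a function of the starting point, in the domain
of the generator. -/
theorem hasGenerator_feynmanKac (M : MarkovProcess E Ω) {μ : Measure E}
    [IsProbabilityMeasure μ] (hμ : M.IsInvariant μ) {W : E → ℝ} (hW : Measurable W)
    {K : ℝ} (hK : ∀ x, |W x| ≤ K) (t : ℝ≥0) :
    M.HasGenerator μ (M.feynmanKac W t fun _ => 1)
      (fun x => M.feynmanKac W t W x - W x * M.feynmanKac W t (fun _ => 1) x) := by
  have hum := M.measurable_feynmanKac hW (f := fun _ => (1 : ℝ)) measurable_const t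
  have hvm := M.measurable_feynmanKac hW hW t
  have hub : ∀ x, |M.feynmanKac W t (fun _ => 1) x| ≤ Real.exp (K * t) * 1 := fun x =>
    M.abs_feynmanKac_le hK (fun _ => by simp) t.coe_nonneg le_rfl x
  have hvb : ∀ x, |M.feynmanKac W t W x| ≤ Real.exp (K * t) * K := fun x =>
    M.abs_feynmanKac_le hK hK t.coe_nonneg le_rfl x
  have hkm : Measurable fun x => M.feynmanKac W t W x - W x * M.feynmanKac W t (fun _ => 1) x :=
    hvm.sub (hW.mul hum)
  refine ⟨MemLp.of_bound hum.aestronglyMeasurable _ (Eventually.of_forall hub),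
    MemLp.of_bound hkm.aestronglyMeasurable (Real.exp (K * t) * K + K * (Real.exp (K * t) * 1))
      (Eventually.of_forall fun x => ?_), ?_⟩
  · refine (abs_sub _ _).trans (add_le_add (hvb x) ?_)
    rw [abs_mul]
    exact mul_le_mul (hK x) (hub x) (abs_nonneg _) ((abs_nonneg _).trans (hK x))
  -- By the Markov property and `X_0 = x` under `P_x`, the difference quotient minus the candidate
  -- image is the mean of the pathwise expansion error.
  have hrepr : ∀ (h : ℝ≥0) (x : E), (h : ℝ)⁻¹ * (M.semigroup h (M.feynmanKac W t fun _ => 1) x -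
      M.feynmanKac W t (fun _ => 1) x) -
      (M.feynmanKac W t W x - W x * M.feynmanKac W t (fun _ => 1) x) =
      ∫ ω, M.expansionError W t h ω ∂(M.law x) := by
    intro h x
    have m1 := Real.measurable_exp.comp (measurable_additive hW M.measurable_X h (h + t))
    have m2 := Real.measurable_exp.comp (measurable_additive hW M.measurable_X 0 t)
    have i1 : Integrable (fun ω => Real.exp (additive W M.X h (h + t) ω)) (M.law x) :=
      integrable_of_abs_le m1
        (exp_additive_le hK M.X (le_add_of_nonneg_right t.coe_nonneg))
    have i2 : Integrable (fun ω => Real.exp (additive W M.X 0 t ω)) (M.law x) :=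
      integrable_of_abs_le m2 (exp_additive_le hK M.X t.coe_nonneg)
    have i3 : ∀ s : ℝ≥0, Integrable (fun ω => Real.exp (additive W M.X 0 t ω) * W (M.X s ω))
        (M.law x) := fun s =>
      integrable_of_abs_le (B := Real.exp (K * (t - 0)) * K)
        (m2.mul (hW.comp (M.measurable_X_at s))) fun ω => by
          rw [abs_mul]
          exact mul_le_mul (exp_additive_le hK M.X t.coe_nonneg ω) (hK _) (abs_nonneg _)
            (Real.exp_pos _).le
    have i4 : ∫ ω, Real.exp (additive W M.X 0 t ω) * W (M.X 0 ω) ∂(M.law x) =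
        W x * ∫ ω, Real.exp (additive W M.X 0 t ω) ∂(M.law x) := by
      rw [mul_comm, ← integral_mul_const]
      refine integral_congr_ae ?_
      filter_upwards [M.ae_X_zero hW x] with ω hω
      rw [hω]
    simp only [expansionError, mul_sub]
    have j1 : Integrable (fun ω => (h : ℝ)⁻¹ * Real.exp (additive W M.X h (h + t) ω) -
        (h : ℝ)⁻¹ * Real.exp (additive W M.X 0 t ω)) (M.law x) :=
      (i1.const_mul _).sub (i2.const_mul _)
    have j2 : Integrable (fun ω => Real.exp (additive W M.X 0 t ω) * W (M.X t ω) -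
        Real.exp (additive W M.X 0 t ω) * W (M.X 0 ω)) (M.law x) := (i3 t).sub (i3 0)
    rw [M.semigroup_feynmanKac_one hW hK t.coe_nonneg, integral_sub j1 j2,
      integral_sub (i1.const_mul _) (i2.const_mul _), integral_sub (i3 t) (i3 0), i4]
    simp only [integral_const_mul, feynmanKac, mul_one, Real.toNNReal_coe]
  simp only [hrepr]
  have hcoe : Tendsto (fun h : ℝ≥0 => (h : ℝ)) (𝓝 0) (𝓝 0) :=
    NNReal.continuous_coe.tendsto' 0 0 rfl
  have e2 : ∀ᶠ h : ℝ≥0 in 𝓝[>] 0, 2 * K * h < 1 := by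
    have : Tendsto (fun h : ℝ≥0 => 2 * K * (h : ℝ)) (𝓝 0) (𝓝 0) := by
      simpa using hcoe.const_mul (2 * K)
    exact (this.mono_left nhdsWithin_le_nhds).eventually_lt_const one_pos
  have hlim : Tendsto (fun h : ℝ≥0 => ENNReal.ofReal (Real.sqrt (Real.exp (K * t) * (6 * K) *
      ∫ ω, |M.expansionError W t h ω| ∂(M.initLaw μ)))) (𝓝[>] 0) (𝓝 0) := by
    have := ENNReal.tendsto_ofReal (((M.tendsto_integral_abs_expansionError hμ hW hK t).const_mul
      (Real.exp (K * t) * (6 * K))).sqrt)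
    simpa using this
  refine tendsto_of_tendsto_of_tendsto_of_le_of_le' tendsto_const_nhds hlim
    (Eventually.of_forall fun _ => zero_le) ?_
  filter_upwards [e2, self_mem_nhdsWithin] with h h2 hpos
  have hle := fun ω => (M.abs_expansionError_le hW hK t hpos h2.le ω).1
  have hEm := M.measurable_expansionError hW t h
  have hgm : Measurable fun x => ∫ ω, M.expansionError W t h ω ∂(M.law x) :=
    hEm.stronglyMeasurable.integral_kernel.measurable
  refine (eLpNorm_two_le_sqrt hgm (fun x => abs_integral_le_of_abs_le hle)).trans ?_
  refine ENNReal.ofReal_le_ofReal (Real.sqrt_le_sqrt ?_)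
  have hcoef : 0 ≤ Real.exp (K * t) * (6 * K) := by
    obtain ⟨ω⟩ : Nonempty Ω := nonempty_of_isProbabilityMeasure (M.initLaw μ)
    exact (abs_nonneg _).trans (hle ω)
  refine mul_le_mul_of_nonneg_left ?_ hcoef
  have hEi : ∀ (Q : Measure Ω) [IsProbabilityMeasure Q],
      Integrable (fun ω => |M.expansionError W t h ω|) Q := fun Q _ =>
    (integrable_of_abs_le hEm hle).abs
  rw [integral_initLaw _ _ (hEi _)]
  refine integral_mono_of_nonneg (Eventually.of_forall fun _ => abs_nonneg _) ?_
    (Eventually.of_forall fun x => abs_integral_le_integral_abs)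
  refine integrable_of_abs_le (B := Real.exp (K * t) * (6 * K))
    hEm.abs.stronglyMeasurable.integral_kernel.measurable fun x => ?_
  exact abs_integral_le_of_abs_le fun ω => by rw [abs_abs]; exact hle ω

/-- The Feynman-Kac bound: a bound on the quadratic form of `L + W` gives a growth bound in
`L²(μ)`. -/
theorem integral_feynmanKac_sq_le (M : MarkovProcess E Ω) {μ : Measure E}
    [IsProbabilityMeasure μ] (hμ : M.IsInvariant μ) {W : E → ℝ} (hW : Measurable W)
    {K : ℝ} (hK : ∀ x, |W x| ≤ K) {L : ℝ} (hL : 0 ≤ L)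
    (hform : ∀ (g k : E → ℝ) (B : ℝ), Measurable g → (∀ x, |g x| ≤ B) → M.HasGenerator μ g k →
      ∫ x, W x * g x ^ 2 ∂μ + ∫ x, k x * g x ∂μ ≤ L * ∫ x, g x ^ 2 ∂μ)
    {T : ℝ} (hT : 0 ≤ T) :
    ∫ x, M.feynmanKac W T (fun _ => 1) x ^ 2 ∂μ ≤ Real.exp (2 * L * T) := by
  set u : ℝ → E → ℝ := fun s => M.feynmanKac W s fun _ => 1 with hu
  set v : ℝ → E → ℝ := fun s => M.feynmanKac W s W with hv
  -- Times are clamped to `[0, T]`, so that measurability and bounds hold for every real `s`, as the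
  -- lemmas on bounded functions require.
  set p : ℝ → ℝ := fun s => max 0 (min s T) with hp
  have hpm : Measurable p := by fun_prop
  have hp0 : ∀ s, 0 ≤ p s := fun s => le_max_left _ _
  have hpT : ∀ s, p s ≤ T := fun s => max_le hT (min_le_right _ _)
  have hpid : ∀ s ∈ Set.Icc 0 T, p s = s := fun s hs => by
    simp only [hp, min_eq_left hs.2, max_eq_right hs.1]
  have hum : Measurable fun q : ℝ × E => u (p q.1) q.2 :=
    (M.measurable_feynmanKac_prod hW (f := fun _ => (1 : ℝ)) measurable_const).comp
      ((hpm.comp measurable_fst).prodMk measurable_snd)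
  have hvm : Measurable fun q : ℝ × E => v (p q.1) q.2 :=
    (M.measurable_feynmanKac_prod hW hW).comp
      ((hpm.comp measurable_fst).prodMk measurable_snd)
  have hub : ∀ s x, |u (p s) x| ≤ Real.exp (K * T) * 1 := fun s x =>
    M.abs_feynmanKac_le hK (fun _ => by simp) (hp0 s) (hpT s) x
  have hvb : ∀ s x, |v (p s) x| ≤ Real.exp (K * T) * K := fun s x =>
    M.abs_feynmanKac_le hK hK (hp0 s) (hpT s) x
  set B : ℝ := 2 * (Real.exp (K * T) * 1) * (Real.exp (K * T) * K) with hB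
  have hFm : Measurable fun q : ℝ × E => 2 * u (p q.1) q.2 * v (p q.1) q.2 :=
    (hum.const_mul 2).mul hvm
  have hFb : ∀ s x, |2 * u (p s) x * v (p s) x| ≤ B := fun s x => by
    rw [abs_mul, abs_mul, abs_two]
    exact mul_le_mul (mul_le_mul_of_nonneg_left (hub s x) zero_le_two) (hvb s x) (abs_nonneg _)
      (by positivity)
  set ψ : ℝ → ℝ := fun s => ∫ x, 2 * u (p s) x * v (p s) x ∂μ with hψ
  have hψm : Measurable ψ := measurable_integral_prod hFm
  have hψb : ∀ s, |ψ s| ≤ B := fun s => abs_integral_le_of_abs_le (hFb s)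
  have hψi := intervalIntegrable_of_bounded hψm hψb
  -- Defined as a primitive, `φ` is continuous for free; it is identified with `‖u_t‖²` on `[0, T]`
  -- by applying the chain rule to `y ↦ y²` for each fixed `x`.
  set φ : ℝ → ℝ := fun t => 1 + ∫ s in (0 : ℝ)..t, ψ s with hφ
  have hφc : Continuous φ := continuous_const.add (intervalIntegral.continuous_primitive hψi 0)
  have hφu : ∀ t ∈ Set.Icc 0 T, φ t = ∫ x, u t x ^ 2 ∂μ := by
    intro t ht
    have hsub : ∀ s ∈ Set.Icc 0 t, p s = s := fun s hs => hpid s ⟨hs.1, hs.2.trans ht.2⟩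
    have hux : ∀ x, ∀ s ∈ Set.Icc 0 t, u s x = 1 + ∫ r in (0 : ℝ)..s, v (p r) x := by
      intro x s hs
      change M.feynmanKac W s (fun _ => 1) x = _
      rw [M.feynmanKac_one_eq hW hK hs.1]
      congr 1
      refine intervalIntegral.integral_congr fun r hr => ?_
      rw [Set.uIcc_of_le hs.1] at hr
      simp only [hv, hsub r ⟨hr.1, hr.2.trans hs.2⟩]
    have hpath : ∀ x, u t x ^ 2 = 1 + ∫ s in (0 : ℝ)..t, 2 * u (p s) x * v (p s) x := by
      intro x
      have hvx : Measurable fun s => v (p s) x :=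
        hvm.comp (measurable_id.prodMk measurable_const)
      have h := comp_integral_sub_eq hvx (fun s => hvb s x) (Φ := fun y => y ^ 2)
        (contDiff_id.pow 2) 1 0 t
      rw [← hux x t ⟨ht.1, le_rfl⟩] at h
      have h2 : ∫ s in (0 : ℝ)..t, 2 * u (p s) x * v (p s) x =
          ∫ s in (0 : ℝ)..t, deriv (fun y : ℝ => y ^ 2) (1 + ∫ r in (0 : ℝ)..s, v (p r) x) *
            v (p s) x := by
        refine intervalIntegral.integral_congr fun s hs => ?_
        rw [Set.uIcc_of_le ht.1] at hs
        rw [← hux x s hs, hsub s hs]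
        simp
      rw [h2, ← h]
      ring
    simp only [hpath]
    rw [integral_add (integrable_const _), integral_intervalIntegral_comm hFm ht.1
      (fun s _ x => hFb s x)]
    · simp [hφ, hψ]
    · refine integrable_of_abs_le ((measurable_intervalIntegral_prod hFm).comp
        (measurable_prodMk_left (x := ((0 : ℝ), t)))) (B := B * |t - 0|) fun x => ?_
      exact abs_intervalIntegral_le (fun s => hFb s x) _ _
  have hψle : ∀ s ∈ Set.Icc 0 T, ψ s ≤ 2 * L * φ s := by
    intro s hs
    rw [hφu s hs]
    -- The image of `u_s` under the generator is `v_s - W u_s`. The potential terms cancel in the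
    -- form inequality, which thus bounds `⟨v_s, u_s⟩ = ψ s / 2`.
    have hgen := M.hasGenerator_feynmanKac hμ hW hK s.toNNReal
    rw [Real.coe_toNNReal _ hs.1] at hgen
    have hus : Measurable (u s) := M.measurable_feynmanKac hW measurable_const s
    have hvs : Measurable (v s) := M.measurable_feynmanKac hW hW s
    have hubs : ∀ x, |u s x| ≤ Real.exp (K * T) * 1 := fun x => hpid s hs ▸ hub s x
    have hvbs : ∀ x, |v s x| ≤ Real.exp (K * T) * K := fun x => hpid s hs ▸ hvb s x
    have h := hform _ _ _ hus hubs hgen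
    have hk0 : ∀ x : E, 0 ≤ K := fun x => (abs_nonneg _).trans (hK x)
    have i1 : Integrable (fun x => W x * u s x ^ 2) μ :=
      integrable_of_abs_le (hW.mul (hus.pow_const 2)) (B := K * (Real.exp (K * T) * 1) ^ 2)
        fun x => by
          rw [abs_mul, abs_pow]
          exact mul_le_mul (hK x) (pow_le_pow_left₀ (abs_nonneg _) (hubs x) 2) (by positivity)
            (hk0 x)
    have i2 : Integrable (fun x => v s x * u s x) μ :=
      integrable_of_abs_le (hvs.mul hus)
        (B := Real.exp (K * T) * K * (Real.exp (K * T) * 1)) fun x => by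
          rw [abs_mul]
          exact mul_le_mul (hvbs x) (hubs x) (abs_nonneg _) ((abs_nonneg _).trans (hvbs x))
    have e : ∫ x, (v s x - W x * u s x) * u s x ∂μ =
        ∫ x, v s x * u s x ∂μ - ∫ x, W x * u s x ^ 2 ∂μ := by
      rw [← integral_sub i2 i1]
      exact integral_congr_ae (Eventually.of_forall fun x => by simp only; ring)
    have e2 : ψ s = 2 * ∫ x, v s x * u s x ∂μ := by
      simp only [hψ, hpid s hs]
      rw [← integral_const_mul]
      exact integral_congr_ae (Eventually.of_forall fun x => by simp only; ring)
    change ∫ x, W x * u s x ^ 2 ∂μ + ∫ x, (v s x - W x * u s x) * u s x ∂μ ≤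
      L * ∫ x, u s x ^ 2 ∂μ at h
    rw [e] at h
    rw [e2]
    linarith
  have hgr := le_exp_of_le_add_integral hφc (A := 1) (L := 2 * L) (by positivity) hT (by
    intro t ht
    rw [← intervalIntegral.integral_const_mul]
    refine add_le_add le_rfl (intervalIntegral.integral_mono_on ht.1 (hψi _ _)
      ((hφc.const_mul _).intervalIntegrable _ _) fun s hs => hψle s ⟨hs.1, hs.2.trans ht.2⟩))
  rw [hφu T ⟨hT, le_rfl⟩, one_mul] at hgr
  exact hgr

end MarkovProcess

/-! ## Normalised Young functions -/

namespace IsContractive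

variable {F : ℝ → ℝ}

theorem young_le (hF : IsContractive F) {x : ℝ} (hx : 0 ≤ x) (y : ℝ) :
    x * y ≤ youngOf F x + youngConj (youngOf F) y := by
  have : x * y - youngOf F x ≤ youngConj (youngOf F) y :=
    le_ciSup (hF.bddAbove_conj y) ⟨x, hx⟩
  linarith

theorem conj_nonneg (hF : IsContractive F) (y : ℝ) : 0 ≤ youngConj (youngOf F) y := by
  have := hF.young_le le_rfl y
  rw [hF.map_zero] at this
  linarith

theorem monotone_conj (hF : IsContractive F) : Monotone (youngConj (youngOf F)) := fun _ z hyz =>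
  ciSup_mono (hF.bddAbove_conj z) fun x =>
    sub_le_sub_right (mul_le_mul_of_nonneg_left hyz x.coe_nonneg) _

theorem young_one_le (hF : IsContractive F) : youngOf F 1 ≤ 1 := by
  have := hF.conj_nonneg 1
  linarith [hF.normalised]

/-- Normalisation is equality in Young's inequality at the pair `(1, 1)`, so the line of slope `1`
through `(1, G(1))` supports `G`. -/
theorem tangent_le (hF : IsContractive F) {x : ℝ} (hx : 0 ≤ x) :
    x - 1 + youngOf F 1 ≤ youngOf F x := by
  have := hF.young_le hx 1
  linarith [hF.normalised]

end IsContractive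

/-- Meant for truncations `W` of `V`: since `G^*` is monotone, every `u` admissible for `V` serves
for `W`. -/
theorem integral_conj_le_of_admissible {E : Type*} [MeasurableSpace E] {μ : Measure E}
    {F : ℝ → ℝ} (hF : IsContractive F) {V W : E → ℝ} (hW : Measurable W) (hVW : ∀ x, |W x| ≤ |V x|)
    {u : ℝ} (hu : 0 < u)
    (hadm : ∫⁻ x, ENNReal.ofReal (youngConj (youngOf F) (|V x| / u)) ∂μ ≤
      ENNReal.ofReal (youngConj (youngOf F) 1)) :
    Integrable (fun x => youngConj (youngOf F) (|W x| / u)) μ ∧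
      ∫ x, youngConj (youngOf F) (|W x| / u) ∂μ ≤ youngConj (youngOf F) 1 := by
  have hm : Measurable fun x => youngConj (youngOf F) (|W x| / u) :=
    hF.monotone_conj.measurable.comp (hW.abs.div_const u)
  have hle : ∫⁻ x, ENNReal.ofReal (youngConj (youngOf F) (|W x| / u)) ∂μ ≤
      ENNReal.ofReal (youngConj (youngOf F) 1) :=
    (lintegral_mono fun x => ENNReal.ofReal_le_ofReal
      (hF.monotone_conj (div_le_div_of_nonneg_right (hVW x) hu.le))).trans hadm
  have h0 : 0 ≤ᵐ[μ] fun x => youngConj (youngOf F) (|W x| / u) :=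
    Eventually.of_forall fun x => hF.conj_nonneg _
  constructor
  · exact (lintegral_ofReal_ne_top_iff_integrable hm.aestronglyMeasurable h0).1
      (ne_top_of_le_ne_top ENNReal.ofReal_ne_top hle)
  · rw [integral_eq_lintegral_of_nonneg_ae h0 hm.aestronglyMeasurable]
    exact ENNReal.toReal_le_of_le_ofReal (hF.conj_nonneg 1) hle

/-- The Hölder-Young inequality for the gauge norm. -/
theorem integral_abs_mul_sq_le_gaugeNorm {E : Type*} [MeasurableSpace E] {μ : Measure E}
    {F : ℝ → ℝ} (hF : IsContractive F) {V W : E → ℝ} (hW : Measurable W) (hVW : ∀ x, |W x| ≤ |V x|)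
    (hN : gaugeNorm (youngConj (youngOf F)) μ V ≠ ∞) {g : E → ℝ}
    (hG : Integrable (fun x => youngOf F (g x ^ 2)) μ)
    (hpos : 0 < ∫ x, youngOf F (g x ^ 2) ∂μ + youngConj (youngOf F) 1) :
    ∫ x, |W x| * g x ^ 2 ∂μ ≤ (gaugeNorm (youngConj (youngOf F)) μ V).toReal *
      (∫ x, youngOf F (g x ^ 2) ∂μ + youngConj (youngOf F) 1) := by
  -- After division by the positive factor, the bound is checked against each admissible `u`, so the
  -- infimum need not be attained.
  rw [← div_le_iff₀ hpos, ← ENNReal.ofReal_le_iff_le_toReal hN]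
  refine le_iInf fun u => le_iInf fun hu => le_iInf fun hadm => ENNReal.ofReal_le_ofReal ?_
  obtain ⟨h1, h2⟩ := integral_conj_le_of_admissible hF hW hVW hu hadm
  rw [div_le_iff₀ hpos]
  calc ∫ x, |W x| * g x ^ 2 ∂μ
      ≤ ∫ x, u * (youngOf F (g x ^ 2) + youngConj (youngOf F) (|W x| / u)) ∂μ := by
        refine integral_mono_of_nonneg (Eventually.of_forall fun x => by positivity)
          ((hG.add h1).const_mul u) (Eventually.of_forall fun x => ?_)
        have := mul_le_mul_of_nonneg_left (hF.young_le (sq_nonneg (g x)) (|W x| / u)) hu.le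
        refine le_trans (le_of_eq ?_) this
        field_simp
    _ = u * (∫ x, youngOf F (g x ^ 2) ∂μ + ∫ x, youngConj (youngOf F) (|W x| / u) ∂μ) := by
        rw [integral_const_mul, integral_add hG h1]
    _ ≤ _ := by gcongr

namespace MarkovProcess

variable {E Ω : Type*} [MeasurableSpace E] [MeasurableSpace Ω]

/-! ## The generator -/

/-- Conservativeness makes `P_t` fix constants. Centring and rescaling therefore stay in the domain,
as needed to test the Sobolev inequality. -/
theorem HasGenerator.affine {M : MarkovProcess E Ω} {μ : Measure E}
    [IsProbabilityMeasure μ] {g k : E → ℝ} (hg : Measurable g) {B : ℝ} (hB : ∀ x, |g x| ≤ B)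
    (h : M.HasGenerator μ g k) (c a : ℝ) :
    M.HasGenerator μ (fun x => c * (g x - a)) (fun x => c * k x) := by
  obtain ⟨h1, h2, h3⟩ := h
  refine ⟨(h1.sub (memLp_const a)).const_mul c, h2.const_mul c, ?_⟩
  have hs : ∀ (t : ℝ≥0) (x : E), M.semigroup t (fun x => c * (g x - a)) x =
      c * (M.semigroup t g x - a) := by
    intro t x
    simp only [semigroup]
    rw [integral_const_mul, integral_sub (integrable_of_abs_le hg hB) (integrable_const _)]
    simp
  have he : ∀ t : ℝ≥0, eLpNorm (fun x => (t : ℝ)⁻¹ * (M.semigroup t (fun x => c * (g x - a)) x -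
      c * (g x - a)) - c * k x) 2 μ =
      ‖c‖ₑ * eLpNorm (fun x => (t : ℝ)⁻¹ * (M.semigroup t g x - g x) - k x) 2 μ := by
    intro t
    rw [← eLpNorm_const_smul]
    congr 1
    ext x
    rw [hs, Pi.smul_apply, smul_eq_mul]
    ring
  simp only [he]
  simpa using ENNReal.Tendsto.const_mul h3 (Or.inr (enorm_ne_top (x := c)))

/-- Invariance makes every difference quotient centred, and the mean is continuous for `L²`
convergence. -/
theorem HasGenerator.integral_eq_zero {M : MarkovProcess E Ω} {μ : Measure E}
    [IsProbabilityMeasure μ] (hμ : M.IsInvariant μ) {g k : E → ℝ} (hg : Measurable g) {B : ℝ}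
    (hB : ∀ x, |g x| ≤ B) (h : M.HasGenerator μ g k) : ∫ x, k x ∂μ = 0 := by
  obtain ⟨h1, h2, h3⟩ := h
  have hgi : Integrable g μ := integrable_of_abs_le hg hB
  have hsi : ∀ t : ℝ≥0, Integrable (M.semigroup t g) μ := fun t =>
    integrable_of_abs_le (M.measurable_semigroup t hg) (M.abs_semigroup_le t hB)
  have hi : ∀ t : ℝ≥0, Integrable (fun x => (t : ℝ)⁻¹ * (M.semigroup t g x - g x)) μ := fun t =>
    ((hsi t).sub hgi).const_mul _
  have hz : ∀ t : ℝ≥0, ∫ x, (t : ℝ)⁻¹ * (M.semigroup t g x - g x) ∂μ = 0 := fun t => by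
    rw [integral_const_mul, integral_sub (hsi t) hgi, integral_semigroup M hμ t hgi, sub_self,
      mul_zero]
  have hlim : Tendsto (fun t : ℝ≥0 => ∫ x, (t : ℝ)⁻¹ * (M.semigroup t g x - g x) ∂μ) (𝓝[>] 0)
      (𝓝 (∫ x, k x ∂μ)) := by
    refine tendsto_integral_of_L1 _ h2.1 (Eventually.of_forall hi) ?_
    refine tendsto_of_tendsto_of_tendsto_of_le_of_le tendsto_const_nhds h3 (fun _ => zero_le)
      fun t => ?_
    simp only
    rw [← eLpNorm_one_eq_lintegral_enorm]
    exact eLpNorm_le_eLpNorm_of_exponent_le one_le_two ((hi t).1.sub h2.1)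
  simp only [hz] at hlim
  exact tendsto_nhds_unique hlim tendsto_const_nhds

/-- Under the strong `F`-Sobolev inequality, the quadratic form of `L + l W` is bounded. -/
theorem form_le_of_strongFSobolev {M : MarkovProcess E Ω} {μ : Measure E}
    [IsProbabilityMeasure μ] (hμ : M.IsInvariant μ) {F : ℝ → ℝ} (hF : IsContractive F) {C : ℝ}
    (hC : 0 < C) (hSob : StrongFSobolev M μ F C) {V W : E → ℝ} (hW : Measurable W) {K : ℝ}
    (hK : ∀ x, |W x| ≤ K) (hVW : ∀ x, |W x| ≤ |V x|) {m : ℝ} (hm : ∫ x, W x ^ 2 ∂μ ≤ m ^ 2)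
    (hG : 0 < youngOf F 1) (hN : gaugeNorm (youngConj (youngOf F)) μ V ≠ ∞) {l : ℝ} (hl : 0 ≤ l)
    (hlN : l * (2 * C * (gaugeNorm (youngConj (youngOf F)) μ V).toReal) ≤ youngOf F 1)
    {g k : E → ℝ} {B : ℝ} (hg : Measurable g) (hB : ∀ x, |g x| ≤ B) (hgen : M.HasGenerator μ g k) :
    ∫ x, (l * W x) * g x ^ 2 ∂μ + ∫ x, k x * g x ∂μ ≤
      (2 * m ^ 2 * C / youngOf F 1 * l ^ 2 + l * |∫ x, W x ∂μ|) * ∫ x, g x ^ 2 ∂μ := by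
  set G₁ := youngOf F 1 with hG₁
  set N := (gaugeNorm (youngConj (youngOf F)) μ V).toReal with hNdef
  set a : ℝ := ∫ x, g x ∂μ with ha
  set β : ℝ := ∫ x, (g x - a) ^ 2 ∂μ with hβ
  have hβ0 : 0 ≤ β := integral_nonneg fun _ => sq_nonneg _
  have hk0 : ∫ x, k x ∂μ = 0 := hgen.integral_eq_zero hμ hg hB
  have hki : Integrable k μ := hgen.2.1.integrable one_le_two
  have hgi : Integrable g μ := integrable_of_abs_le hg hB
  have hkg : Integrable (fun x => k x * g x) μ := hgen.2.1.integrable_mul hgen.1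
  have hga : ∀ x, |g x - a| ≤ B + |a| := fun x => (abs_sub _ _).trans (by gcongr; exact hB x)
  have hgam : Measurable fun x => g x - a := hg.sub_const a
  have hsq : Integrable (fun x => (g x - a) ^ 2) μ :=
    integrable_of_abs_le (hgam.pow_const 2) (B := (B + |a|) ^ 2) fun x => by
      rw [abs_pow]; exact pow_le_pow_left₀ (abs_nonneg _) (hga x) 2
  have hdecomp : ∫ x, g x ^ 2 ∂μ = a ^ 2 + β := by
    have e : ∀ x, g x ^ 2 = (2 * a * g x - a ^ 2) + (g x - a) ^ 2 := fun x => by ring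
    have i1 : Integrable (fun x => 2 * a * g x - a ^ 2) μ :=
      (hgi.const_mul _).sub (integrable_const _)
    simp only [e]
    rw [integral_add i1 hsq, integral_sub (hgi.const_mul _) (integrable_const _),
      integral_const_mul, ← ha]
    simp only [integral_const, probReal_univ, one_smul]
    ring
  have hkga : ∫ x, k x * (g x - a) ∂μ = ∫ x, k x * g x ∂μ := by
    simp only [mul_sub]
    rw [integral_sub hkg (hki.mul_const a), integral_mul_const, hk0]
    ring
  have hWi : Integrable W μ := integrable_of_abs_le hW hK
  set L : ℝ := 2 * m ^ 2 * C / G₁ * l ^ 2 with hL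
  have hL0 : 0 ≤ L := by positivity
  have hWabs : l * a ^ 2 * ∫ x, W x ∂μ ≤ l * |∫ x, W x ∂μ| * a ^ 2 := by
    have := mul_le_mul_of_nonneg_left (le_abs_self (∫ x, W x ∂μ))
      (mul_nonneg hl (sq_nonneg a))
    linarith
  have hend : 0 ≤ (L + l * |∫ x, W x ∂μ|) * β := by positivity
  rw [hdecomp]
  -- If the variance vanishes, `g` is almost surely constant and only the mean of `W` contributes;
  -- otherwise `g` can be normalised.
  rcases hβ0.eq_or_lt with hβz | hβpos
  · have hae : (fun x => (g x - a) ^ 2) =ᵐ[μ] 0 :=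
      (integral_eq_zero_iff_of_nonneg (fun _ => sq_nonneg _) hsq).1 hβz.symm
    have hae' : ∀ᵐ x ∂μ, g x = a := by
      filter_upwards [hae] with x hx
      exact sub_eq_zero.1 (pow_eq_zero_iff two_ne_zero |>.1 hx)
    have e1 : ∫ x, (l * W x) * g x ^ 2 ∂μ = l * a ^ 2 * ∫ x, W x ∂μ := by
      rw [← integral_const_mul]
      refine integral_congr_ae ?_
      filter_upwards [hae'] with x hx
      rw [hx]; ring
    have e2 : ∫ x, k x * g x ∂μ = 0 := by
      rw [← hkga, ← integral_zero E ℝ (μ := μ)]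
      refine integral_congr_ae ?_
      filter_upwards [hae'] with x hx
      rw [hx]; ring
    rw [e1, e2]
    nlinarith [mul_nonneg hL0 (sq_nonneg a)]
  · set b : ℝ := Real.sqrt β with hb
    have hbpos : 0 < b := Real.sqrt_pos.2 hβpos
    have hb2 : b ^ 2 = β := Real.sq_sqrt hβ0
    set h : E → ℝ := fun x => b⁻¹ * (g x - a) with hh
    have hgenh := hgen.affine hg hB b⁻¹ a
    have hhm : Measurable h := hgam.const_mul _
    have hhB : ∀ x, |h x| ≤ b⁻¹ * (B + |a|) := fun x => by
      rw [hh, abs_mul, abs_of_pos (inv_pos.2 hbpos)]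
      exact mul_le_mul_of_nonneg_left (hga x) (inv_pos.2 hbpos).le
    have hh0 : ∫ x, h x ∂μ = 0 := by
      rw [hh, integral_const_mul, integral_sub hgi (integrable_const _), ← ha]
      simp
    have hh1 : ∫ x, h x ^ 2 ∂μ = 1 := by
      simp only [hh, mul_pow]
      rw [integral_const_mul, ← hβ, ← hb2, inv_pow, inv_mul_cancel₀ (by positivity)]
    obtain ⟨hGi, hSle⟩ := hSob h _ hgenh hh0 hh1
    change Integrable (fun x => youngOf F (h x ^ 2)) μ at hGi
    change ∫ x, youngOf F (h x ^ 2) ∂μ ≤ _ at hSle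
    set S : ℝ := ∫ x, youngOf F (h x ^ 2) ∂μ with hS
    have hh2i : Integrable (fun x => h x ^ 2) μ :=
      integrable_of_abs_le (hhm.pow_const 2) (B := (b⁻¹ * (B + |a|)) ^ 2) fun x => by
        rw [abs_pow]; exact pow_le_pow_left₀ (abs_nonneg _) (hhB x) 2
    -- Jensen's inequality through the supporting line at `1`, since `∫ h² = 1`.
    have hSG : G₁ ≤ S := by
      have i1 : Integrable (fun x => h x ^ 2 - 1 + G₁) μ :=
        (hh2i.sub (integrable_const _)).add (integrable_const _)
      have h1 : ∫ x, (h x ^ 2 - 1 + G₁) ∂μ ≤ S :=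
        integral_mono i1 hGi fun x => hF.tangent_le (sq_nonneg (h x))
      rw [integral_add (f := fun x => h x ^ 2 - 1) (hh2i.sub (integrable_const _))
        (integrable_const _), integral_sub hh2i (integrable_const _), hh1] at h1
      simpa using h1
    have hconj : youngConj (youngOf F) 1 = 1 - G₁ := by linarith [hF.normalised]
    have hpos : 0 < S + youngConj (youngOf F) 1 := by rw [hconj]; linarith
    have hY := integral_abs_mul_sq_le_gaugeNorm hF hW hVW hN hGi hpos
    rw [← hNdef, ← hS, hconj] at hY
    -- The dissipation. Because `∫ k = 0`, replacing `g` by `g - a` does not change `∫ k g`.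
    have hkS : ∫ x, k x * g x ∂μ ≤ -(β * S / C) := by
      have e : ∫ x, (b⁻¹ * k x) * h x ∂μ = β⁻¹ * ∫ x, k x * g x ∂μ := by
        rw [← hkga, ← integral_const_mul, ← hb2]
        refine integral_congr_ae (Eventually.of_forall fun x => ?_)
        simp only [hh]
        field_simp
      rw [e] at hSle
      have h1 : S * β ≤ -C * ∫ x, k x * g x ∂μ := by
        have := mul_le_mul_of_nonneg_right hSle hβ0
        have e2 : -C * (β⁻¹ * ∫ x, k x * g x ∂μ) * β = -C * ∫ x, k x * g x ∂μ := by
          field_simp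
        rwa [e2] at this
      rw [le_neg, div_le_iff₀ hC]
      linarith
    -- Half of the dissipation pays for this term. Here `S + G^*(1) = S + 1 - G₁ ≤ S / G₁`, as `G₁ ≤
    -- 1` and `G₁ ≤ S`; the bound on `l` then yields exactly `S / (2C)`.
    have hWh : l * ∫ x, |W x| * h x ^ 2 ∂μ ≤ S / (2 * C) := by
      have h1 : S + (1 - G₁) ≤ S / G₁ := by
        rw [le_div_iff₀ hG]
        nlinarith [hF.young_one_le]
      have hN0 : 0 ≤ N := ENNReal.toReal_nonneg
      have hS0 : 0 ≤ S / G₁ := div_nonneg (hG.le.trans hSG) hG.le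
      calc l * ∫ x, |W x| * h x ^ 2 ∂μ ≤ l * (N * (S / G₁)) := by
            refine mul_le_mul_of_nonneg_left (hY.trans ?_) hl
            exact mul_le_mul_of_nonneg_left h1 hN0
        _ = (l * (2 * C * N)) * (S / G₁) / (2 * C) := by field_simp
        _ ≤ G₁ * (S / G₁) / (2 * C) := by gcongr
        _ = S / (2 * C) := by field_simp
    -- The weight in `2xy ≤ x²/c + c y²` for the cross term: `c β ≤ β S / (2C)` uses the other half
    -- of the dissipation, and `1/c` produces the constant `2C / G₁`.
    set c : ℝ := G₁ / (2 * C) with hc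
    have hcpos : 0 < c := by positivity
    have hW2i : Integrable (fun x => W x ^ 2) μ :=
      integrable_of_abs_le (hW.pow_const 2) (B := K ^ 2) fun x => by
        rw [abs_pow]; exact pow_le_pow_left₀ (abs_nonneg _) (hK x) 2
    have hWhi : Integrable (fun x => |W x| * h x ^ 2) μ :=
      integrable_of_abs_le (hW.abs.mul (hhm.pow_const 2)) (B := K * (b⁻¹ * (B + |a|)) ^ 2)
        fun x => by
          rw [abs_mul, abs_abs, abs_pow]
          exact mul_le_mul (hK x) (pow_le_pow_left₀ (abs_nonneg _) (hhB x) 2) (by positivity)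
            ((abs_nonneg _).trans (hK x))
    have hWgi : Integrable (fun x => (l * W x) * g x ^ 2) μ :=
      integrable_of_abs_le ((hW.const_mul l).mul (hg.pow_const 2)) (B := l * K * B ^ 2)
        fun x => by
          rw [abs_mul, abs_mul, abs_pow, abs_of_nonneg hl]
          have := (abs_nonneg _).trans (hK x)
          exact mul_le_mul (mul_le_mul_of_nonneg_left (hK x) hl)
            (pow_le_pow_left₀ (abs_nonneg _) (hB x) 2) (by positivity) (by positivity)
    have hpt : ∀ x, (l * W x) * g x ^ 2 ≤ (l * a ^ 2 * W x + l ^ 2 * a ^ 2 / c * W x ^ 2) +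
        (c * β * h x ^ 2 + β * l * (|W x| * h x ^ 2)) := by
      intro x
      have hgx : g x = a + b * h x := by
        simp only [hh]
        field_simp
        ring
      have h1 : 2 * (l * a * W x) * (b * h x) ≤ l ^ 2 * a ^ 2 / c * W x ^ 2 +
          c * β * h x ^ 2 := by
        have := div_nonneg (sq_nonneg (l * a * W x - c * (b * h x))) hcpos.le
        have e : (l * a * W x - c * (b * h x)) ^ 2 / c = l ^ 2 * a ^ 2 / c * W x ^ 2 +
          c * b ^ 2 * h x ^ 2 - 2 * (l * a * W x) * (b * h x) := by
          field_simp
          ring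
        rw [e, hb2] at this
        linarith
      have h2 : l * W x * β * h x ^ 2 ≤ β * l * (|W x| * h x ^ 2) := by
        have := mul_le_mul_of_nonneg_left (le_abs_self (W x))
          (mul_nonneg (mul_nonneg hβ0 hl) (sq_nonneg (h x)))
        linarith
      have e : l * W x * g x ^ 2 = l * a ^ 2 * W x + 2 * (l * a * W x) * (b * h x) +
          l * W x * β * h x ^ 2 := by
        rw [hgx, ← hb2]; ring
      rw [e]
      linarith
    have i1 : Integrable (fun x => l * a ^ 2 * W x + l ^ 2 * a ^ 2 / c * W x ^ 2) μ :=
      (hWi.const_mul _).add (hW2i.const_mul _)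
    have i2 : Integrable (fun x => c * β * h x ^ 2 + β * l * (|W x| * h x ^ 2)) μ :=
      (hh2i.const_mul _).add (hWhi.const_mul _)
    have hint := integral_mono hWgi (i1.add i2) hpt
    simp only [Pi.add_apply] at hint
    rw [integral_add i1 i2, integral_add (hWi.const_mul _) (hW2i.const_mul _),
      integral_add (hh2i.const_mul _) (hWhi.const_mul _)] at hint
    simp only [integral_const_mul] at hint
    rw [hh1] at hint
    have t1 : l ^ 2 * a ^ 2 / c * ∫ x, W x ^ 2 ∂μ ≤ L * a ^ 2 := by
      calc l ^ 2 * a ^ 2 / c * ∫ x, W x ^ 2 ∂μ ≤ l ^ 2 * a ^ 2 / c * m ^ 2 := by gcongr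
        _ = L * a ^ 2 := by rw [hL, hc]; field_simp
    have t2 : β * l * ∫ x, |W x| * h x ^ 2 ∂μ ≤ β * (S / (2 * C)) := by
      rw [mul_assoc]
      exact mul_le_mul_of_nonneg_left hWh hβ0
    have t3 : c * β ≤ β * (S / (2 * C)) := by
      rw [mul_comm]
      refine mul_le_mul_of_nonneg_left ?_ hβ0
      rw [hc]
      gcongr
    have t4 : β * (S / (2 * C)) + β * (S / (2 * C)) = β * S / C := by
      field_simp
      norm_num
    linarith

end MarkovProcess

/-! ### Change of initial law and optimisation over the exponent. -/

/-- The Cauchy-Schwarz inequality for the density of `ν` with respect to `μ`. -/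
theorem lintegral_le_eLpNorm_rnDeriv_mul {E : Type*} [MeasurableSpace E] {μ ν : Measure E}
    [SigmaFinite μ] [SigmaFinite ν] (hν : ν ≪ μ) {f : E → ℝ≥0∞} (hf : Measurable f) :
    ∫⁻ x, f x ∂ν ≤ eLpNorm (ν.rnDeriv μ) 2 μ * (∫⁻ x, f x ^ (2 : ℝ) ∂μ) ^ (1 / 2 : ℝ) := by
  rw [← lintegral_rnDeriv_mul hν hf.aemeasurable,
    eLpNorm_eq_lintegral_rpow_enorm_toReal two_ne_zero ENNReal.ofNat_ne_top]
  have hpq : (2 : ℝ).HolderConjugate 2 := Real.HolderConjugate.two_two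
  simpa using ENNReal.lintegral_mul_le_Lp_mul_Lq μ hpq (Measure.measurable_rnDeriv ν μ).aemeasurable
    hf.aemeasurable

theorem one_le_eLpNorm_rnDeriv {E : Type*} [MeasurableSpace E] {μ ν : Measure E}
    [IsProbabilityMeasure μ] [IsProbabilityMeasure ν] (hν : ν ≪ μ) :
    1 ≤ eLpNorm (ν.rnDeriv μ) 2 μ := by
  simpa using lintegral_le_eLpNorm_rnDeriv_mul hν (f := fun _ => 1) measurable_const

/-- A positive admissible exponent excludes the degenerate conventions for `λ₂`; clearing the
denominator remains correct when the gauge norm is `0`. -/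
theorem exists_pos_of_le_lambdaTwo {E : Type*} [MeasurableSpace E] {μ : Measure E} {F : ℝ → ℝ}
    {C : ℝ} (hC : 0 < C) {V : E → ℝ} {l : ℝ} (hl : 0 < l)
    (h : ENNReal.ofReal l ≤ lambdaTwo F C μ V) :
    0 < youngOf F 1 ∧ gaugeNorm (youngConj (youngOf F)) μ V ≠ ∞ ∧
      l * (2 * C * (gaugeNorm (youngConj (youngOf F)) μ V).toReal) ≤ youngOf F 1 := by
  have hl' : ENNReal.ofReal l ≠ 0 := by simpa using hl
  have hC' : ENNReal.ofReal C ≠ 0 := by simpa using hC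
  rw [lambdaTwo] at h
  have hG : 0 < youngOf F 1 := by
    by_contra hG
    rw [ENNReal.ofReal_of_nonpos (not_lt.1 hG), ENNReal.zero_div] at h
    exact hl' (le_zero_iff.1 h)
  have hN : gaugeNorm (youngConj (youngOf F)) μ V ≠ ∞ := by
    intro hN
    rw [hN, ENNReal.mul_top (mul_ne_zero two_ne_zero hC'), ENNReal.div_top] at h
    exact hl' (le_zero_iff.1 h)
  refine ⟨hG, hN, ?_⟩
  rw [ENNReal.le_div_iff_mul_le (Or.inr (by simpa using hG)) (Or.inr ENNReal.ofReal_ne_top)] at h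
  have := ENNReal.toReal_mono ENNReal.ofReal_ne_top h
  simpa [ENNReal.toReal_mul, hl.le, hC.le, hG.le] using this

/-- Exponential bounds for all admissible exponents give the bound by the deviation rate. -/
theorem le_mul_exp_deviationRate {p K : ℝ≥0∞} (hK : K ≠ ∞) {t : ℝ} (ht : 0 < t)
    {G₁ C m R : ℝ} {l₂ : ℝ≥0∞}
    (h : ∀ l : ℝ, 0 ≤ l → ENNReal.ofReal l ≤ l₂ →
      p ≤ K * ENNReal.ofReal (Real.exp (-(t * (R * l - (2 * m ^ 2 * C / G₁) * l ^ 2))))) :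
    p ≤ K * EReal.exp (-((t : EReal) * deviationRate G₁ C m R l₂)) := by
  rcases eq_or_ne K 0 with rfl | hK0
  · have := h 0 le_rfl (by simp)
    simpa using this
  have ht' : (0 : EReal) < t := by exact_mod_cast ht
  -- Taking logarithms in `EReal` turns the claim into an upper bound on the supremum, which can be
  -- tested one exponent at a time even when the rate is infinite.
  rw [mul_comm, ← ENNReal.div_le_iff_le_mul (Or.inl hK0) (Or.inl hK), ← ENNReal.exp_log (p / K),
    EReal.exp_le_exp_iff, EReal.le_neg, mul_comm,
    ← EReal.le_div_iff_mul_le ht' (EReal.coe_ne_top t)]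
  refine iSup_le fun l => iSup_le fun hl => ?_
  rw [EReal.le_div_iff_mul_le ht' (EReal.coe_ne_top t), EReal.le_neg, ← EReal.exp_le_exp_iff,
    ENNReal.exp_log, ENNReal.div_le_iff_le_mul (Or.inl hK0) (Or.inl hK), mul_comm,
    ← EReal.coe_mul, ← EReal.coe_neg, EReal.exp_coe]
  rw [mul_comm _ t]
  exact h l hl.1 hl.2

/-! ### Path integrals, exponential moments and the deviation bound. -/

namespace MarkovProcess

variable {E Ω : Type*} [MeasurableSpace E] [MeasurableSpace Ω]

theorem initLaw_absolutelyContinuous (M : MarkovProcess E Ω) {μ ν : Measure E} (hν : ν ≪ μ) :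
    M.initLaw ν ≪ M.initLaw μ :=
  hν.comp_right M.law

/-- Tonelli and stationarity: the mean occupation measure up to `t` is `t μ`. Hence integrable
functions are integrable along almost every path, and `μ`-null sets are almost surely occupied for
zero time. -/
theorem lintegral_path_eq (M : MarkovProcess E Ω) {μ : Measure E} [IsProbabilityMeasure μ]
    (hμ : M.IsInvariant μ) {f : E → ℝ≥0∞} (hf : Measurable f) (t : ℝ) :
    ∫⁻ ω, (∫⁻ s in Set.Ioc 0 t, f (M.X s.toNNReal ω)) ∂(M.initLaw μ) =
      ENNReal.ofReal t * ∫⁻ x, f x ∂μ := by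
  have hm : Measurable fun p : Ω × ℝ => f (M.X p.2.toNNReal p.1) :=
    hf.comp (M.measurable_X.comp
      ((measurable_real_toNNReal.comp measurable_snd).prodMk measurable_fst))
  rw [lintegral_lintegral_swap hm.aemeasurable]
  have : ∀ s : ℝ, ∫⁻ ω, f (M.X s.toNNReal ω) ∂(M.initLaw μ) = ∫⁻ x, f x ∂μ := fun s => by
    rw [← lintegral_map hf (M.measurable_X_at _), map_X_initLaw M hμ]
  simp only [this, lintegral_const, Measure.restrict_apply_univ, Real.volume_Ioc, sub_zero]
  rw [mul_comm]

theorem ae_intervalIntegrable_path (M : MarkovProcess E Ω) {μ : Measure E}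
    [IsProbabilityMeasure μ] (hμ : M.IsInvariant μ) {V : E → ℝ} (hVm : Measurable V)
    (hV : Integrable V μ) {t : ℝ} (ht : 0 ≤ t) :
    ∀ᵐ ω ∂(M.initLaw μ), IntervalIntegrable (fun s : ℝ => V (M.X s.toNNReal ω)) volume 0 t := by
  have hm : Measurable fun p : Ω × ℝ => ‖V (M.X p.2.toNNReal p.1)‖ₑ :=
    (hVm.comp (M.measurable_X.comp
      ((measurable_real_toNNReal.comp measurable_snd).prodMk measurable_fst))).enorm
  have hfin : ∫⁻ ω, (∫⁻ s in Set.Ioc 0 t, ‖V (M.X s.toNNReal ω)‖ₑ) ∂(M.initLaw μ) ≠ ∞ := by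
    rw [lintegral_path_eq M hμ (f := fun x => ‖V x‖ₑ) hVm.enorm]
    exact ENNReal.mul_ne_top ENNReal.ofReal_ne_top hV.2.ne
  filter_upwards [ae_lt_top hm.lintegral_prod_right' hfin] with ω hω
  rw [intervalIntegrable_iff_integrableOn_Ioc_of_le ht]
  exact ⟨(measurable_path hVm M.measurable_X ω).aestronglyMeasurable, hω⟩

theorem ae_path_eq (M : MarkovProcess E Ω) {μ : Measure E} [IsProbabilityMeasure μ]
    (hμ : M.IsInvariant μ) {V V' : E → ℝ} (h : V =ᵐ[μ] V') (t : ℝ) :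
    ∀ᵐ ω ∂(M.initLaw μ), (fun s : ℝ => V (M.X s.toNNReal ω)) =ᵐ[volume.restrict (Set.Ioc 0 t)]
      fun s => V' (M.X s.toNNReal ω) := by
  obtain ⟨N, hN, hNm, hN0⟩ := exists_measurable_superset_of_null (ae_iff.1 h)
  have hf : Measurable (N.indicator (1 : E → ℝ≥0∞)) := measurable_one.indicator hNm
  have hz := lintegral_path_eq M hμ hf t
  rw [lintegral_indicator_one hNm, hN0, mul_zero] at hz
  have hm : Measurable fun p : Ω × ℝ => N.indicator (1 : E → ℝ≥0∞) (M.X p.2.toNNReal p.1) :=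
    hf.comp (M.measurable_X.comp
      ((measurable_real_toNNReal.comp measurable_snd).prodMk measurable_fst))
  filter_upwards [(lintegral_eq_zero_iff hm.lintegral_prod_right').1 hz] with ω hω
  have hm' : Measurable fun s : ℝ => N.indicator (1 : E → ℝ≥0∞) (M.X s.toNNReal ω) :=
    hm.comp measurable_prodMk_left
  filter_upwards [(lintegral_eq_zero_iff hm').1 hω] with s hs
  by_contra hne
  have : M.X s.toNNReal ω ∈ N := hN hne
  simp [this] at hs

/-- The exponential moment of an additive functional under a general initial law. -/
theorem lintegral_exp_additive_le (M : MarkovProcess E Ω) {μ : Measure E}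
    [IsProbabilityMeasure μ] (hμ : M.IsInvariant μ) {W : E → ℝ} (hW : Measurable W)
    {K : ℝ} (hK : ∀ x, |W x| ≤ K) {L : ℝ} (hL : 0 ≤ L)
    (hform : ∀ (g k : E → ℝ) (B : ℝ), Measurable g → (∀ x, |g x| ≤ B) → M.HasGenerator μ g k →
      ∫ x, W x * g x ^ 2 ∂μ + ∫ x, k x * g x ∂μ ≤ L * ∫ x, g x ^ 2 ∂μ)
    {ν : Measure E} [IsProbabilityMeasure ν] (hν : ν ≪ μ) {t : ℝ} (ht : 0 ≤ t) :
    ∫⁻ ω, ENNReal.ofReal (Real.exp (additive W M.X 0 t ω)) ∂(M.initLaw ν) ≤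
      eLpNorm (ν.rnDeriv μ) 2 μ * ENNReal.ofReal (Real.exp (L * t)) := by
  have hem : Measurable fun ω => Real.exp (additive W M.X 0 t ω) :=
    Real.measurable_exp.comp (measurable_additive hW M.measurable_X 0 t)
  set u := M.feynmanKac W t fun _ => 1 with hu
  have hum : Measurable u := M.measurable_feynmanKac hW measurable_const t
  have hub : ∀ x, |u x| ≤ Real.exp (K * t) * 1 := fun x =>
    M.abs_feynmanKac_le hK (fun _ => by simp) ht le_rfl x
  have hu0 : ∀ x, 0 ≤ u x := fun x => integral_nonneg fun ω => by positivity
  have h1 : ∫⁻ ω, ENNReal.ofReal (Real.exp (additive W M.X 0 t ω)) ∂(M.initLaw ν) =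
      ∫⁻ x, ENNReal.ofReal (u x) ∂ν := by
    rw [initLaw, Measure.lintegral_bind M.law.measurable.aemeasurable
      hem.ennreal_ofReal.aemeasurable]
    refine lintegral_congr fun x => ?_
    rw [← ofReal_integral_eq_lintegral_ofReal]
    · simp only [hu, feynmanKac, mul_one]
    · exact integrable_of_abs_le hem (exp_additive_le hK M.X ht)
    · exact Eventually.of_forall fun _ => (Real.exp_pos _).le
  rw [h1]
  refine (lintegral_le_eLpNorm_rnDeriv_mul hν hum.ennreal_ofReal).trans ?_
  gcongr
  have h2 : ∫⁻ x, ENNReal.ofReal (u x) ^ (2 : ℝ) ∂μ = ENNReal.ofReal (∫ x, u x ^ 2 ∂μ) := by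
    rw [ofReal_integral_eq_lintegral_ofReal]
    · refine lintegral_congr fun x => ?_
      rw [ENNReal.rpow_ofNat, ENNReal.ofReal_pow (hu0 x)]
    · exact integrable_of_abs_le (hum.pow_const 2) (B := (Real.exp (K * t) * 1) ^ 2) fun x => by
        rw [abs_pow]; exact pow_le_pow_left₀ (abs_nonneg _) (hub x) 2
    · exact Eventually.of_forall fun _ => sq_nonneg _
  rw [h2, ENNReal.ofReal_rpow_of_nonneg (integral_nonneg fun _ => sq_nonneg _) (by norm_num)]
  refine ENNReal.ofReal_le_ofReal ?_
  have h3 := M.integral_feynmanKac_sq_le hμ hW hK hL hform ht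
  calc (∫ x, u x ^ 2 ∂μ) ^ (1 / 2 : ℝ) ≤ Real.exp (2 * L * t) ^ (1 / 2 : ℝ) :=
        Real.rpow_le_rpow (integral_nonneg fun _ => sq_nonneg _) h3 (by norm_num)
    _ = Real.exp (L * t) := by
        rw [← Real.exp_mul]
        congr 1
        ring

theorem lintegral_exp_mul_additive_le_of_strongFSobolev {M : MarkovProcess E Ω} {μ : Measure E}
    [IsProbabilityMeasure μ] (hμ : M.IsInvariant μ) {F : ℝ → ℝ} (hF : IsContractive F) {C : ℝ}
    (hC : 0 < C) (hSob : StrongFSobolev M μ F C) {V : E → ℝ} (hVm : Measurable V)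
    (hV : MemLp V 2 μ) (hV0 : ∫ x, V x ∂μ = 0) {m : ℝ} (hm : ∫ x, V x ^ 2 ∂μ = m ^ 2)
    {ν : Measure E} [IsProbabilityMeasure ν] (hν : ν ≪ μ) (hνtop : eLpNorm (ν.rnDeriv μ) 2 μ ≠ ∞)
    {l : ℝ} (hl : 0 < l) (hlam : ENNReal.ofReal l ≤ lambdaTwo F C μ V) {t : ℝ} (ht : 0 ≤ t) :
    ∫⁻ ω, ENNReal.ofReal (Real.exp (l * additive V M.X 0 t ω)) ∂(M.initLaw ν) ≤
      eLpNorm (ν.rnDeriv μ) 2 μ *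
        ENNReal.ofReal (Real.exp ((2 * m ^ 2 * C / youngOf F 1 * l ^ 2) * t)) := by
  obtain ⟨hG, hN, hlN⟩ := exists_pos_of_le_lambdaTwo hC hl hlam
  -- Truncation preserves `|V_n| ≤ |V|`, hence the gauge and `L²` bounds, but not the mean; the form
  -- bound keeps the error term `l |∫ V_n|` for this reason.
  set Vn : ℕ → E → ℝ := fun n x => max (-(n : ℝ)) (min (V x) n) with hVn
  have hVnm : ∀ n, Measurable (Vn n) := fun n => measurable_const.max (hVm.min measurable_const)
  have hVnb : ∀ n x, |Vn n x| ≤ n := fun n x => by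
    have hn : (0 : ℝ) ≤ n := n.cast_nonneg
    exact abs_le.2 ⟨le_max_left _ _, max_le (by linarith) (min_le_right _ _)⟩
  have hVnV : ∀ n x, |Vn n x| ≤ |V x| := fun n x => by
    have hn : (0 : ℝ) ≤ n := n.cast_nonneg
    refine abs_le.2 ⟨?_, max_le (by linarith [abs_nonneg (V x)])
      ((min_le_left _ _).trans (le_abs_self _))⟩
    refine le_max_of_le_right (le_min (neg_abs_le _) (by linarith [abs_nonneg (V x)]))
  have hVnlim : ∀ x, Tendsto (fun n => Vn n x) atTop (𝓝 (V x)) := fun x => by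
    refine tendsto_const_nhds.congr' ?_
    filter_upwards [eventually_ge_atTop ⌈|V x|⌉₊] with n hn
    have hn' : |V x| ≤ n := (Nat.le_ceil _).trans (by exact_mod_cast hn)
    simp only [hVn]
    rw [min_eq_left ((le_abs_self _).trans hn'), max_eq_right (by linarith [neg_abs_le (V x)])]
  have hVi : Integrable V μ := hV.integrable one_le_two
  have hmeanlim : Tendsto (fun n => ∫ x, Vn n x ∂μ) atTop (𝓝 0) := by
    rw [← hV0]
    exact tendsto_integral_of_dominated_convergence (fun x => |V x|)
      (fun n => (hVnm n).aestronglyMeasurable) hVi.abs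
      (fun n => Eventually.of_forall (hVnV n)) (Eventually.of_forall hVnlim)
  have hmn : ∀ n, ∫ x, Vn n x ^ 2 ∂μ ≤ m ^ 2 := fun n => by
    rw [← hm]
    exact integral_mono_of_nonneg (Eventually.of_forall fun _ => sq_nonneg _) hV.integrable_sq
      (Eventually.of_forall fun x => sq_le_sq.2 (hVnV n x))
  have hbound : ∀ n, ∫⁻ ω, ENNReal.ofReal (Real.exp (additive (fun x => l * Vn n x) M.X 0 t ω))
      ∂(M.initLaw ν) ≤ eLpNorm (ν.rnDeriv μ) 2 μ * ENNReal.ofReal (Real.exp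
        ((2 * m ^ 2 * C / youngOf F 1 * l ^ 2 + l * |∫ x, Vn n x ∂μ|) * t)) := fun n =>
    M.lintegral_exp_additive_le hμ ((hVnm n).const_mul l) (K := l * n)
      (fun x => by
        rw [abs_mul, abs_of_pos hl]
        exact mul_le_mul_of_nonneg_left (hVnb n x) hl.le)
      (by positivity)
      (fun g k B hg hB hgen => form_le_of_strongFSobolev hμ hF hC hSob (hVnm n) (hVnb n) (hVnV n)
        (hmn n) hG hN hl.le hlN hg hB hgen) hν ht
  have hlim : Tendsto (fun n => eLpNorm (ν.rnDeriv μ) 2 μ * ENNReal.ofReal (Real.exp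
      ((2 * m ^ 2 * C / youngOf F 1 * l ^ 2 + l * |∫ x, Vn n x ∂μ|) * t))) atTop
      (𝓝 (eLpNorm (ν.rnDeriv μ) 2 μ *
        ENNReal.ofReal (Real.exp ((2 * m ^ 2 * C / youngOf F 1 * l ^ 2) * t)))) := by
    refine ENNReal.Tendsto.const_mul (ENNReal.tendsto_ofReal ?_) (Or.inr hνtop)
    refine (Real.continuous_exp.tendsto _).comp ?_
    simpa using (((hmeanlim.abs).const_mul l).const_add
      (2 * m ^ 2 * C / youngOf F 1 * l ^ 2)).mul_const t
  -- Along almost every path the truncated functionals converge by domination by `|V|`, so Fatou's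
  -- lemma transfers the moment bounds.
  have hpath : ∀ᵐ ω ∂(M.initLaw ν), ENNReal.ofReal (Real.exp (l * additive V M.X 0 t ω)) =
      liminf (fun n => ENNReal.ofReal (Real.exp (additive (fun x => l * Vn n x) M.X 0 t ω)))
        atTop := by
    filter_upwards [(M.initLaw_absolutelyContinuous hν).ae_le
      (M.ae_intervalIntegrable_path hμ hVm hVi ht)] with ω hω
    refine (Tendsto.liminf_eq (ENNReal.tendsto_ofReal ?_)).symm
    refine (Real.continuous_exp.tendsto _).comp ?_
    simp only [additive]
    simp only [intervalIntegral.integral_const_mul]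
    refine Tendsto.const_mul l ?_
    refine intervalIntegral.tendsto_integral_filter_of_dominated_convergence
      (fun s => |V (M.X s.toNNReal ω)|) (Eventually.of_forall fun n => ?_)
      (Eventually.of_forall fun n => Eventually.of_forall fun s _ => hVnV n _) hω.abs
      (Eventually.of_forall fun s _ => hVnlim _)
    exact (measurable_path (hVnm n) M.measurable_X ω).aestronglyMeasurable
  rw [lintegral_congr_ae hpath]
  refine (lintegral_liminf_le fun n => ?_).trans ?_
  · exact (Real.measurable_exp.comp
      (measurable_additive ((hVnm n).const_mul l) M.measurable_X 0 t)).ennreal_ofReal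
  · rw [← hlim.liminf_eq]
    exact liminf_le_liminf (Eventually.of_forall hbound)

theorem initLaw_le_of_strongFSobolev {M : MarkovProcess E Ω} {μ : Measure E}
    [IsProbabilityMeasure μ] (hμ : M.IsInvariant μ) {F : ℝ → ℝ} (hF : IsContractive F) {C : ℝ}
    (hC : 0 < C) (hSob : StrongFSobolev M μ F C) {V : E → ℝ} (hVm : Measurable V)
    (hV : MemLp V 2 μ) (hV0 : ∫ x, V x ∂μ = 0) {m : ℝ} (hm : ∫ x, V x ^ 2 ∂μ = m ^ 2)
    {ν : Measure E} [IsProbabilityMeasure ν] (hν : ν ≪ μ) {t : ℝ} (ht : 0 < t) (R : ℝ) :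
    M.initLaw ν {ω | R ≤ (1 / t) * ∫ s in (0 : ℝ)..t, V (M.X s.toNNReal ω)} ≤
      eLpNorm (ν.rnDeriv μ) 2 μ *
        EReal.exp (-((t : EReal) * deviationRate (youngOf F 1) C m R (lambdaTwo F C μ V))) := by
  have main : ∀ (ν : Measure E) [IsProbabilityMeasure ν], ν ≪ μ →
      eLpNorm (ν.rnDeriv μ) 2 μ ≠ ∞ →
      M.initLaw ν {ω | R ≤ (1 / t) * ∫ s in (0 : ℝ)..t, V (M.X s.toNNReal ω)} ≤
      eLpNorm (ν.rnDeriv μ) 2 μ *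
        EReal.exp (-((t : EReal) * deviationRate (youngOf F 1) C m R (lambdaTwo F C μ V))) := by
    intro ν _ hν hνtop
    refine le_mul_exp_deviationRate hνtop ht fun l hl hlam => ?_
    -- At `l = 0` the bound only says that a probability is at most the norm of the density, which
    -- is at least `1`.
    rcases hl.eq_or_lt with rfl | hlpos
    · simpa using prob_le_one.trans (one_le_eLpNorm_rnDeriv hν)
    have hmom := lintegral_exp_mul_additive_le_of_strongFSobolev hμ hF hC hSob hVm hV hV0 hm hν
      hνtop hlpos hlam ht.le
    have hem : Measurable fun ω => ENNReal.ofReal (Real.exp (l * additive V M.X 0 t ω)) :=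
      (Real.measurable_exp.comp
        ((measurable_additive hVm M.measurable_X 0 t).const_mul l)).ennreal_ofReal
    have hmarkov := (mul_meas_ge_le_lintegral (μ := M.initLaw ν) hem
      (ENNReal.ofReal (Real.exp (l * (R * t))))).trans hmom
    have hsub : {ω | R ≤ (1 / t) * ∫ s in (0 : ℝ)..t, V (M.X s.toNNReal ω)} ⊆
        {ω | ENNReal.ofReal (Real.exp (l * (R * t))) ≤
          ENNReal.ofReal (Real.exp (l * additive V M.X 0 t ω))} := by
      intro ω hω
      refine ENNReal.ofReal_le_ofReal (Real.exp_le_exp.2 (mul_le_mul_of_nonneg_left ?_ hl))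
      have h1 : R ≤ (1 / t) * additive V M.X 0 t ω := hω
      rw [one_div, inv_mul_eq_div, le_div_iff₀ ht] at h1
      exact h1
    refine (measure_mono hsub).trans ?_
    have hpos : ENNReal.ofReal (Real.exp (l * (R * t))) ≠ 0 := by
      simpa using Real.exp_pos (l * (R * t))
    rw [mul_comm, ← ENNReal.le_div_iff_mul_le (Or.inl hpos) (Or.inl ENNReal.ofReal_ne_top),
      mul_div_assoc, ← ENNReal.ofReal_div_of_pos (Real.exp_pos _), ← Real.exp_sub] at hmarkov
    refine hmarkov.trans (le_of_eq ?_)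
    congr 3
    ring
  -- When the density is not in `L²` the right side is `∞`, unless the exponential vanishes and `∞ ·
  -- 0 = 0`. In that case the bound for `μ` itself makes the event `P_μ`-null, hence `P_ν`-null.
  by_cases hνtop : eLpNorm (ν.rnDeriv μ) 2 μ = ∞
  · by_cases hexp :
        EReal.exp (-((t : EReal) * deviationRate (youngOf F 1) C m R (lambdaTwo F C μ V))) = 0
    · have hself : eLpNorm (μ.rnDeriv μ) 2 μ ≠ ∞ := by
        rw [eLpNorm_congr_ae (Measure.rnDeriv_self μ),
          eLpNorm_eq_lintegral_rpow_enorm_toReal two_ne_zero ENNReal.ofNat_ne_top]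
        simp
      have h := main μ Measure.AbsolutelyContinuous.rfl hself
      rw [hexp, mul_zero] at h
      rw [M.initLaw_absolutelyContinuous hν (le_zero_iff.1 h)]
      exact zero_le
    · rw [hνtop, ENNReal.top_mul hexp]
      exact le_top
  · exact main ν hν hνtop

end MarkovProcess

theorem gaugeNorm_congr_ae {E : Type*} [MeasurableSpace E] {Φ : ℝ → ℝ} {μ : Measure E}
    {V V' : E → ℝ} (h : V =ᵐ[μ] V') : gaugeNorm Φ μ V = gaugeNorm Φ μ V' := by
  have : ∀ u : ℝ, ∫⁻ x, ENNReal.ofReal (Φ (|V x| / u)) ∂μ =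
      ∫⁻ x, ENNReal.ofReal (Φ (|V' x| / u)) ∂μ := fun u =>
    lintegral_congr_ae (by filter_upwards [h] with x hx; rw [hx])
  simp only [gaugeNorm, this]

theorem mainTheorem4 {E Ω : Type*} [TopologicalSpace E] [PolishSpace E] [MeasurableSpace E]
    [BorelSpace E] [MeasurableSpace Ω] (M : MarkovProcess E Ω)
    (μ : Measure E) [IsProbabilityMeasure μ] (hμ : M.IsInvariant μ)
    (F : ℝ → ℝ) (hF : IsContractive F) (C : ℝ) (hC : 0 < C) (hSob : StrongFSobolev M μ F C)
    (V : E → ℝ) (hV : MemLp V 2 μ) (hV0 : ∫ x, V x ∂μ = 0) (m : ℝ) (hm : ∫ x, V x ^ 2 ∂μ = m ^ 2)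
    (ν : Measure E) [IsProbabilityMeasure ν] (hν : ν ≪ μ) (t R : ℝ) (ht : 0 < t) (hR : 0 < R) :
    (∀ᵐ ω ∂(M.initLaw ν), IntervalIntegrable (fun s : ℝ => V (M.X s.toNNReal ω)) volume 0 t) ∧
      M.initLaw ν {ω | R ≤ (1 / t) * ∫ s in (0 : ℝ)..t, V (M.X s.toNNReal ω)} ≤
        eLpNorm (ν.rnDeriv μ) 2 μ *
          EReal.exp (-((t : EReal) * deviationRate (youngOf F 1) C m R (lambdaTwo F C μ V))) := by
  -- `V` is replaced by a Borel version; both functions have the same integrals along almost every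
  -- path because null sets are occupied for zero time.
  set V' : E → ℝ := hV.1.aemeasurable.mk V with hV'
  have hVm' : Measurable V' := hV.1.aemeasurable.measurable_mk
  have hae : V =ᵐ[μ] V' := hV.1.aemeasurable.ae_eq_mk
  have hVL : MemLp V' 2 μ := hV.ae_eq hae
  have hac := (M.initLaw_absolutelyContinuous hν).ae_le
  have hpath := hac (M.ae_path_eq hμ hae t)
  have hint := hac (M.ae_intervalIntegrable_path hμ hVm' (hVL.integrable one_le_two) ht.le)
  constructor
  · filter_upwards [hpath, hint] with ω h1 h2
    rw [intervalIntegrable_iff_integrableOn_Ioc_of_le ht.le] at h2 ⊢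
    exact h2.congr h1.symm
  · have hset : M.initLaw ν {ω | R ≤ (1 / t) * ∫ s in (0 : ℝ)..t, V (M.X s.toNNReal ω)} =
        M.initLaw ν {ω | R ≤ (1 / t) * ∫ s in (0 : ℝ)..t, V' (M.X s.toNNReal ω)} := by
      refine measure_congr ?_
      filter_upwards [hpath] with ω h1
      have : ∫ s in (0 : ℝ)..t, V (M.X s.toNNReal ω) =
          ∫ s in (0 : ℝ)..t, V' (M.X s.toNNReal ω) := by
        rw [intervalIntegral.integral_of_le ht.le, intervalIntegral.integral_of_le ht.le]
        exact integral_congr_ae h1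
      exact congrArg (fun z : ℝ => R ≤ (1 / t) * z) this
    have hlam : lambdaTwo F C μ V = lambdaTwo F C μ V' := by
      rw [lambdaTwo, lambdaTwo, gaugeNorm_congr_ae hae]
    rw [hset, hlam]
    refine MarkovProcess.initLaw_le_of_strongFSobolev hμ hF hC hSob hVm' hVL ?_ ?_ hν ht R
    · rw [← hV0]
      exact integral_congr_ae hae.symm
    · rw [← hm]
      refine integral_congr_ae ?_
      filter_upwards [hae] with x hx
      rw [hx]
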